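/- For $q\in\mathbb{Z}$ let $BS(1,q)=\langle a,b\mid aba^{-1}=b^{q}\rangle$ (so $BS(1,0)\cong\mathbb{Z}$). A left-order on a group $G$ is a strict total order $\prec$ on $G$ with $g\prec h\iff fg\prec fh$ for all $f,g,h\in G$; its positive cone is $P_\prec=\{g\in G: 1\prec g\}$. A finite generating set of $G$ is a finite set $X$ with a surjective monoid homomorphism $\pi\colon X^*\to G$. The left-order $\prec$ is *regular* (respectively *one-counter*) with respect to $(X,\pi)$ if $\pi(\mathcal L)=P_\prec$ for some regular (respectively one-counter) language $\mathcal L\subseteq X^*$; a language is one-counter if it is accepted, by final state, by a nondeterministic pushdown automaton with finitely many states, whose stack alphabet has exactly one letter and whose moves may depend on whether the stack is empty. **Theorem.** Let $q\in\mathbb{Z}$ and let $(X,\pi)$ be any finite generating set of $BS(1,q)$. Then: 1. $BS(1,q)$ admits a left-order that is one-counter with respect to $(X,\pi)$. 2. $BS(1,q)$ admits a left-order that is regular with respect to $(X,\pi)$ if and only if $q\ge -1$. 3. If $q\ge 2$, then every left-order $\prec$ on $BS(1,q)$ that is regular with respect to $(X,\pi)$ is induced by the affine action of $BS(1,q)$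 on $\mathbb{R}$ given by $a\colon x\mapsto qx$, $b\colon x\mapsto x+1$. That is, there are a point $x\in\mathbb{R}$ and a left-order $\prec'$ on the stabilizer $\mathrm{Stab}(x)$, with positive cone $P'$, such that either, for all $g,h\in BS(1,q)$, $$g\prec h\iff g(x)<h(x)\ \text{ or }\ g^{-1}h\in P',$$ or, for all $g,h\in BS(1,q)$, $$g\prec h\iff g(x)>h(x)\ \text{ or }\ g^{-1}h\in P'.$$ -/

import Mathlib

/-! ### Pushdown automata and one-counter languages -/

/-- A nondeterministic pushdown automaton with input alphabet `X`, state set `S` and stack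
alphabet `Γ`. In `δ s o t`, `o = none` is a spontaneous move (no input letter is read), and `t` is
the last letter of the stack word, with `t = none` when the stack is empty. -/
structure PDA (X S Γ : Type*) where
  /-- the transition function -/
  δ : S → Option X → Option Γ → Set (S × List Γ)
  finite_δ : ∀ s o t, (δ s o t).Finite
  /-- the initial state -/
  start : S
  /-- the initial stack word -/
  stack₀ : List Γ
  /-- the accepting states -/
  accept : Set S

namespace PDA

variable {X S Γ : Type*}

/-- One move: in state `s` with stack word `u`, the last letter of `u` (if any) is deleted and
a word is appended, as allowed by the transition function. -/
def Step (M : PDA X S Γ) (c : S × List Γ) (o : Option X) (c' : S × List Γ) : Prop :=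
  ∃ v : List Γ, (c'.1, v) ∈ M.δ c.1 o c.2.getLast? ∧ c'.2 = c.2.dropLast ++ v

/-- `M.Run c w c'`: some finite sequence of moves leads from the configuration `c` to `c'` while
reading exactly the word `w`. -/
inductive Run (M : PDA X S Γ) : S × List Γ → List X → S × List Γ → Prop
  | nil (c : S × List Γ) : Run M c [] c
  | cons {c c' c'' : S × List Γ} {o : Option X} {w : List X} :
      M.Step c o c' → Run M c' w c'' → Run M c (o.toList ++ w) c''

/-- The language accepted by `M` (acceptance by state, with any final stack word). -/
def accepts (M : PDA X S Γ) : Language X :=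
  {w | ∃ c : S × List Γ, M.Run (M.start, M.stack₀) w c ∧ c.1 ∈ M.accept}

end PDA

/-- A language is one-counter if it is accepted by a nondeterministic pushdown automaton with
finitely many states whose stack alphabet has exactly one letter. -/
def IsOneCounter {X : Type*} (L : Language X) : Prop :=
  ∃ (S Γ : Type) (_ : Finite S) (M : PDA X S Γ), Nat.card Γ = 1 ∧ M.accepts = L

/-! ### Left-orders, and left-orders described by languages -/

/-- `lt` is a (strict) total order on `G` that is invariant under left multiplication. -/
structure IsLeftOrder {G : Type*} [Group G] (lt : G → G → Prop) : Prop where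
  strictTotal : IsStrictTotalOrder G lt
  mul_left_iff : ∀ f g h : G, lt (f * g) (f * h) ↔ lt g h

/-- The positive cone of a left-order. -/
def posCone {G : Type*} [Group G] (lt : G → G → Prop) : Set G := {g | lt 1 g}

/-- Some language over `X` that belongs to the class `C` evaluates onto `P` under `π`. -/
def IsRepresentedBy {X G : Type*} [Group G] (C : Language X → Prop) (π : FreeMonoid X →* G)
    (P : Set G) : Prop :=
  ∃ L : Language X, C L ∧ {g : G | ∃ w ∈ L, π (FreeMonoid.ofList w) = g} = P

/-- `lt` is a regular left-order with respect to the generating set `(X, π)`. -/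
def IsRegularLeftOrder {X G : Type*} [Group G] (π : FreeMonoid X →* G) (lt : G → G → Prop) :
    Prop :=
  IsLeftOrder lt ∧ IsRepresentedBy Language.IsRegular π (posCone lt)

/-- `lt` is a one-counter left-order with respect to the generating set `(X, π)`. -/
def IsOneCounterLeftOrder {X G : Type*} [Group G] (π : FreeMonoid X →* G) (lt : G → G → Prop) :
    Prop :=
  IsLeftOrder lt ∧ IsRepresentedBy IsOneCounter π (posCone lt)

/-! ### Left-orders induced by an action on a totally ordered set -/

/-- The stabilizer of the point `x` under an order-preserving action. -/
def stabAt {G Ω : Type*} [Group G] [LinearOrder Ω] (ρ : G →* (Ω ≃o Ω)) (x : Ω) : Subgroup G where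
  carrier := {g | ρ g x = x}
  one_mem' := by simp
  mul_mem' := by
    intro g h hg hh
    simp only [Set.mem_ofPred_eq, map_mul, RelIso.mul_apply] at *
    rw [hh, hg]
  inv_mem' := by
    intro g hg
    simp only [Set.mem_ofPred_eq] at *
    conv_lhs => rw [← hg]
    rw [← RelIso.mul_apply, ← map_mul]
    simp

/-- The left-order `lt` is induced by the order-preserving action `ρ`: for some base point `x`, two
elements of `G` are compared by the positions of the images of `x` on the line (in its usual
orientation, or in the opposite one), and ties are decided by a left-order on the stabilizer
of `x`. -/
def IsInducedBy {G Ω : Type*} [Group G] [LinearOrder Ω] (ρ : G →* (Ω ≃o Ω)) (lt : G → G → Prop) :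
    Prop :=
  ∃ (x : Ω) (lt' : stabAt ρ x → stabAt ρ x → Prop), IsLeftOrder lt' ∧
    ((∀ g h : G, lt g h ↔
        ρ g x < ρ h x ∨ ∃ s : stabAt ρ x, h = g * (s : G) ∧ lt' 1 s) ∨
     (∀ g h : G, lt g h ↔
        ρ h x < ρ g x ∨ ∃ s : stabAt ρ x, h = g * (s : G) ∧ lt' 1 s))

/-! ### The groups `BS(1, q)` -/

/-- The two generators of the presentation. -/
inductive BSGen
  | a
  | b

/-- The defining relator `a b a⁻¹ (b ^ q)⁻¹`. -/
def bsRel (q : ℤ) : FreeGroup BSGen :=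
  FreeGroup.of .a * FreeGroup.of .b * (FreeGroup.of .a)⁻¹ * (FreeGroup.of .b ^ q)⁻¹

/-- The Baumslag–Solitar group `BS(1, q) = ⟨a, b ∣ a b a⁻¹ = b ^ q⟩`. -/
abbrev BS (q : ℤ) : Type := PresentedGroup ({bsRel q} : Set (FreeGroup BSGen))

/-- The images of the generators under the affine action: `a : x ↦ q x` and `b : x ↦ x + 1`. -/
noncomputable def bsAffineGen (q : ℤ) (hq : 0 < q) : BSGen → (ℝ ≃o ℝ)
  | .a => OrderIso.mulLeft₀ (q : ℝ) (Int.cast_pos.mpr hq)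
  | .b => OrderIso.addRight (1 : ℝ)

theorem addRight_one_zpow_apply (n : ℤ) (x : ℝ) :
    ((OrderIso.addRight (1 : ℝ)) ^ n) x = x + n := by
  induction n using Int.induction_on generalizing x with
  | zero => simp
  | succ k ih =>
    rw [zpow_add, RelIso.mul_apply, ih, zpow_one]
    simp only [OrderIso.addRight_apply]
    push_cast
    ring
  | pred k ih =>
    have h : ((OrderIso.addRight (1 : ℝ))⁻¹ : ℝ ≃o ℝ) x = x - 1 := by
      change (OrderIso.addRight (1 : ℝ)).symm x = x - 1
      simp [sub_eq_add_neg]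
    rw [zpow_sub, zpow_one, RelIso.mul_apply, h, ih]
    push_cast
    ring

theorem bsAffineGen_rel (q : ℤ) (hq : 0 < q) :
    ∀ r ∈ ({bsRel q} : Set (FreeGroup BSGen)), FreeGroup.lift (bsAffineGen q hq) r = 1 := by
  intro r hr
  rw [Set.mem_singleton_iff] at hr
  subst hr
  simp only [bsRel, map_mul, map_inv, map_zpow, FreeGroup.lift_apply_of, bsAffineGen]
  rw [mul_inv_eq_one, mul_inv_eq_iff_eq_mul]
  ext x
  rw [RelIso.mul_apply, RelIso.mul_apply, addRight_one_zpow_apply]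
  simp only [OrderIso.mulLeft₀_apply, OrderIso.addRight_apply]
  ring

/-- The affine action of `BS(1, q)` on the real line, for `q > 0`, determined by
`a : x ↦ q x` and `b : x ↦ x + 1`. -/
noncomputable def bsAffine (q : ℤ) (hq : 0 < q) : BS q →* (ℝ ≃o ℝ) :=
  PresentedGroup.toGroup (bsAffineGen_rel q hq)

/-!
For `q ≠ 0`, `BS(1, q)` is the group of affine maps `x ↦ q ^ h * x + t` of height `h ∈ ℤ` and with
translation part `t ∈ ℤ[1/q]`. Comparing first the translation parts and then the heights gives a
left-order if `q > 0`, and comparing first the heights and then the translation parts gives one for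
every `q ≠ 0`. The first positive cone is a rational set, and so is the second one if `q = ±1`.

In general the elements of height `0` and positive translation part are the products
`a⁻²ⁿ bᵐ⁰ a² bᵐ¹ a² ⋯ a² bᵐⁿ` with exponents `≥ 0` that are not all `0`; one counter suffices to
compare the numbers of letters `a⁻²` and `a²`, so the second positive cone is always one-counter.

Conversely, let `|q| ≥ 2`. In a left-order in which the height dominates, prefixes of accepted words
of height `0` have bounded height if the language is regular, so the translation parts of the
elements of height `0` have a bounded denominator: the left-order is not regular. If the height does
not dominate, the elements of height `0` are cofinal, which forces `q > 0`, and every `g` defines a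
cut among them, that is, a real number `c g`. Then `c` is a cocycle for the affine action, hence
`c g = g x - x` with `x = c a / (q - 1)`, and the left-order is induced by the action at `x`.
-/

/-! ### Left-orders and positive cones -/

section LeftOrder

variable {G : Type*} [Group G]

/-- The positive cones of left-orders on `G`, characterised intrinsically: a subsemigroup `P` such
that `G` is the disjoint union of `P`, `P⁻¹` and `{1}`. -/
structure IsPositiveCone (P : Set G) : Prop where
  mul_mem : ∀ {g h : G}, g ∈ P → h ∈ P → g * h ∈ P
  one_notMem : (1 : G) ∉ P
  mem_or_inv_mem : ∀ {g : G}, g ≠ 1 → g ∈ P ∨ g⁻¹ ∈ P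

theorem IsPositiveCone.isLeftOrder {P : Set G} (hP : IsPositiveCone P) :
    IsLeftOrder (fun g h : G => g⁻¹ * h ∈ P) where
  strictTotal :=
    { trichotomous := fun g h hgh hhg => by
        by_contra hne
        rcases hP.mem_or_inv_mem (mt inv_mul_eq_one.mp hne) with h' | h'
        · exact hgh h'
        · exact hhg (by simpa using h')
      irrefl := fun g => by simpa using hP.one_notMem
      trans := fun f g h hfg hgh => by simpa [mul_assoc] using hP.mul_mem hfg hgh }
  mul_left_iff := fun f g h => by simp [mul_assoc]

theorem posCone_inv_mul_mem (P : Set G) : posCone (fun g h : G => g⁻¹ * h ∈ P) = P := by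
  ext g
  simp [posCone]

/-- The elements that are positive when `G` is ordered lexicographically, first by the sign of `f`
and then, where `f` vanishes, by the sign of `k`. -/
def lexCone {R S : Type*} [Zero R] [LT R] [Zero S] [LT S] (f : G → R) (k : G → S) : Set G :=
  {g | 0 < f g ∨ f g = 0 ∧ 0 < k g}

theorem isPositiveCone_lexCone {R S : Type*} [Ring R] [LinearOrder R] [IsStrictOrderedRing R]
    [AddCommGroup S] [LinearOrder S] [IsOrderedAddMonoid S] {f c : G → R} {k : G → S}
    (c_pos : ∀ g, 0 < c g) (f_mul : ∀ g h, f (g * h) = f g + c g * f h)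
    (k_mul : ∀ g h, f g = 0 → f h = 0 → k (g * h) = k g + k h)
    (eq_one : ∀ g, f g = 0 → k g = 0 → g = 1) : IsPositiveCone (lexCone f k) := by
  have f_one : f 1 = 0 := by simpa [(c_pos 1).ne'] using f_mul 1 1
  have k_one : k 1 = 0 := by simpa using k_mul 1 1 f_one f_one
  have f_inv (g : G) : f g⁻¹ = -(c g⁻¹ * f g) := by
    rw [eq_neg_iff_add_eq_zero, ← f_mul, inv_mul_cancel, f_one]
  refine ⟨?_, by simp [lexCone, f_one, k_one], fun {g} hg => ?_⟩
  · rintro g h (hg | ⟨hg, hkg⟩) (hh | ⟨hh, hkh⟩)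
    · exact Or.inl (by rw [f_mul]; exact add_pos hg (mul_pos (c_pos g) hh))
    · exact Or.inl (by rwa [f_mul, hh, mul_zero, add_zero])
    · exact Or.inl (by rw [f_mul, hg, zero_add]; exact mul_pos (c_pos g) hh)
    · exact Or.inr ⟨by rw [f_mul, hg, hh, mul_zero, add_zero],
        by rw [k_mul g h hg hh]; exact add_pos hkg hkh⟩
  · rcases lt_trichotomy (f g) 0 with hf | hf | hf
    · exact Or.inr (Or.inl (by
        rw [f_inv, neg_pos]; exact mul_neg_of_pos_of_neg (c_pos _) hf))
    · have hf' : f g⁻¹ = 0 := by rw [f_inv, hf, mul_zero, neg_zero]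
      have k_inv : k g⁻¹ = -k g := by
        rw [eq_neg_iff_add_eq_zero, ← k_mul _ _ hf' hf, inv_mul_cancel, k_one]
      rcases lt_trichotomy (k g) 0 with hk | hk | hk
      · exact Or.inr (Or.inr ⟨hf', by rwa [k_inv, neg_pos]⟩)
      · exact absurd (eq_one g hf hk) hg
      · exact Or.inl (Or.inr ⟨hf, hk⟩)
    · exact Or.inl (Or.inl hf)

/-- Up to a choice of orientation `ε`, the sign of `φ` decides the order wherever it is nonzero. -/
def DominatedBy (lt : G → G → Prop) (φ : G →* Multiplicative ℤ) : Prop :=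
  ∃ ε : ℤˣ, ∀ g, 0 < ε * (φ g).toAdd → lt 1 g

/-- `K` is unbounded above for `lt`. -/
def CofinalIn (K : Subgroup G) (lt : G → G → Prop) : Prop :=
  ∀ g, ∃ s ∈ K, lt g s

namespace IsLeftOrder

variable {lt : G → G → Prop} (H : IsLeftOrder lt)
include H

theorem irrefl (g : G) : ¬ lt g g := H.strictTotal.irrefl g

theorem trans {f g h : G} (hfg : lt f g) (hgh : lt g h) : lt f h :=
  H.strictTotal.trans f g h hfg hgh

theorem asymm {g h : G} (hgh : lt g h) : ¬ lt h g := fun hhg => H.irrefl g (H.trans hgh hhg)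

theorem eq_or_lt_or_gt (g h : G) : g = h ∨ lt g h ∨ lt h g := by
  by_contra! hc
  exact hc.1 (H.strictTotal.trichotomous g h hc.2.1 hc.2.2)

theorem lt_iff_one_lt (g h : G) : lt g h ↔ lt 1 (g⁻¹ * h) := by
  rw [← H.mul_left_iff g⁻¹ g h, inv_mul_cancel]

theorem lt_one_iff (g : G) : lt g 1 ↔ lt 1 g⁻¹ := by
  rw [H.lt_iff_one_lt, mul_one]

theorem lt_mul_iff (g h : G) : lt g (g * h) ↔ lt 1 h := by
  rw [H.lt_iff_one_lt, inv_mul_cancel_left]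

theorem one_lt_mul {g h : G} (hg : lt 1 g) (hh : lt 1 h) : lt 1 (g * h) :=
  H.trans hg ((H.lt_mul_iff g h).mpr hh)

theorem one_lt_zpow {g : G} (hg : lt 1 g) {n : ℤ} (hn : 0 < n) : lt 1 (g ^ n) := by
  induction n, hn using Int.leInduction with
  | base => simpa using hg
  | succ n _ ih =>
    rw [zpow_add_one]
    exact H.one_lt_mul ih hg

theorem one_lt_zpow_iff {g : G} {n : ℤ} (hn : 0 < n) : lt 1 (g ^ n) ↔ lt 1 g := by
  refine ⟨fun hgn => ?_, fun hg => H.one_lt_zpow hg hn⟩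
  rcases H.eq_or_lt_or_gt 1 g with rfl | hg | hg
  · rwa [one_zpow] at hgn
  · exact hg
  · rw [H.lt_one_iff] at hg
    have hgn' := H.one_lt_zpow hg hn
    rw [inv_zpow, ← H.lt_one_iff] at hgn'
    exact absurd hgn' (H.asymm hgn)

theorem swap : IsLeftOrder (fun g h => lt h g) where
  strictTotal :=
    { trichotomous := fun g h hhg hgh => H.strictTotal.trichotomous g h hgh hhg
      irrefl := H.irrefl
      trans := fun _ _ _ hgf hhg => H.trans hhg hgf }
  mul_left_iff := fun f g h => H.mul_left_iff f h g

theorem restrict (K : Subgroup G) : IsLeftOrder (fun g h : K => lt g h) where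
  strictTotal :=
    { trichotomous := fun g h hgh hhg => Subtype.ext (H.strictTotal.trichotomous g h hgh hhg)
      irrefl := fun g => H.irrefl g
      trans := fun _ _ _ hfg hgh => H.trans hfg hgh }
  mul_left_iff := fun f g h => by simpa using H.mul_left_iff f g h

theorem exists_mem_lt_of_cofinalIn {K : Subgroup G} [K.Normal] (hK : CofinalIn K lt) (g : G) :
    ∃ s ∈ K, lt s g := by
  obtain ⟨s, hs, hlt⟩ := hK g⁻¹
  refine ⟨(g * s * g⁻¹)⁻¹, inv_mem (‹K.Normal›.conj_mem s hs g), ?_⟩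
  rw [H.lt_iff_one_lt] at hlt ⊢
  simpa using hlt

theorem lt_zpow_of_forall_lt {K : Subgroup G} {g : G} (hg : ∀ s ∈ K, lt s g) {n : ℤ} (hn : 0 < n) :
    ∀ s ∈ K, lt s (g ^ n) := by
  intro s hs
  obtain rfl | hn' := (show 1 ≤ n from hn).eq_or_lt
  · simpa using hg s hs
  · have hone : lt 1 (g ^ (n - 1)) := H.one_lt_zpow (hg 1 (one_mem K)) (sub_pos.mpr hn')
    have hmul : g ^ n = g * g ^ (n - 1) := by rw [← zpow_one_add, add_sub_cancel]
    rw [hmul]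
    exact H.trans (hg s hs) ((H.lt_mul_iff _ _).mpr hone)

theorem one_lt_of_ker_lt {φ : G →* Multiplicative ℤ} {g h : G} (hg : ∀ s ∈ φ.ker, lt s g)
    (hgh : 0 < (φ g).toAdd * (φ h).toAdd) : lt 1 h := by
  set x := (φ g).toAdd with hx
  set y := (φ h).toAdd with hy
  -- The exponents are chosen so that `h ^ (x * x)` and `g ^ (x * y)` have the same image.
  have hker : g ^ (x * y) * (h ^ (x * x))⁻¹ ∈ φ.ker := by
    rw [MonoidHom.mem_ker, ← toAdd_eq_zero]
    simp only [map_mul, map_inv, map_zpow, toAdd_mul, toAdd_inv, toAdd_zpow, smul_eq_mul, ← hx,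
      ← hy]
    ring
  have hlt := H.lt_zpow_of_forall_lt hg hgh _ hker
  rw [H.lt_iff_one_lt] at hlt
  have hxx : 0 < x * x := mul_self_pos.mpr (left_ne_zero_of_mul hgh.ne')
  exact (H.one_lt_zpow_iff hxx).mp (by simpa using hlt)

theorem dominatedBy_or_cofinalIn_ker (φ : G →* Multiplicative ℤ) {t : G} (ht : t ∈ φ.ker)
    (ht1 : lt 1 t) : DominatedBy lt φ ∨ CofinalIn φ.ker lt := by
  by_contra! hc
  obtain ⟨hdom, hcof⟩ := hc
  obtain ⟨g, hg⟩ : ∃ g, ∀ s ∈ φ.ker, ¬ lt g s := by simpa [CofinalIn] using hcof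
  have hker : ∀ s ∈ φ.ker, lt s g := fun s hs => by
    have hst : lt s (s * t) := (H.lt_mul_iff s t).mpr ht1
    rcases H.eq_or_lt_or_gt g (s * t) with heq | hlt | hlt
    · rwa [heq]
    · exact absurd hlt (hg _ (mul_mem hs ht))
    · exact H.trans hst hlt
  have hne : (φ g).toAdd ≠ 0 := fun h0 =>
    H.irrefl g (hker g (MonoidHom.mem_ker.mpr (toAdd_eq_zero.mp h0)))
  rcases hne.lt_or_gt with hneg | hpos
  · exact hdom ⟨-1, fun h hh => H.one_lt_of_ker_lt hker
      (mul_pos_of_neg_of_neg hneg (by simpa using hh))⟩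
  · exact hdom ⟨1, fun h hh => H.one_lt_of_ker_lt hker (mul_pos hpos (by simpa using hh))⟩

end IsLeftOrder

end LeftOrder

/-! ### Height and translation part in `BS(1, q)` -/

namespace BS

variable (q : ℤ)

/-- The generator `a` of `BS(1, q)`. -/
def a : BS q := PresentedGroup.of .a

/-- The generator `b` of `BS(1, q)`. -/
def b : BS q := PresentedGroup.of .b

theorem closure_a_b : Subgroup.closure {a q, b q} = ⊤ := by
  have hrange : Set.range (PresentedGroup.of : BSGen → BS q) = {a q, b q} := by
    ext g
    simp only [Set.mem_range, Set.mem_insert_iff, Set.mem_singleton_iff, a, b]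
    exact ⟨fun ⟨x, hx⟩ => by cases x <;> simp [← hx], by rintro (rfl | rfl) <;> exact ⟨_, rfl⟩⟩
  rw [← hrange, PresentedGroup.closure_range_of]

theorem a_mul_b : a q * b q = b q ^ q * a q := by
  have h : PresentedGroup.mk {bsRel q} (bsRel q) = 1 := PresentedGroup.one_of_mem rfl
  exact mul_inv_eq_iff_eq_mul.mp (mul_inv_eq_one.mp h)

theorem a_mul_b_zpow (m : ℤ) : a q * b q ^ m = b q ^ (q * m) * a q := by
  rw [← mul_inv_eq_iff_eq_mul, ← conj_zpow, a_mul_b, mul_inv_cancel_right, zpow_mul]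

theorem a_pow_mul_b_zpow (n : ℕ) (m : ℤ) : a q ^ n * b q ^ m = b q ^ (q ^ n * m) * a q ^ n := by
  induction n generalizing m with
  | zero => simp
  | succ n ih =>
    rw [pow_succ, mul_assoc, a_mul_b_zpow, ← mul_assoc, ih, mul_assoc, pow_succ, mul_assoc]

theorem b_zpow_mul_inv_a_pow (n : ℕ) (m : ℤ) :
    b q ^ m * (a q ^ n)⁻¹ = (a q ^ n)⁻¹ * b q ^ (q ^ n * m) := by
  rw [eq_inv_mul_iff_mul_eq, ← mul_assoc, a_pow_mul_b_zpow, mul_inv_cancel_right]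

theorem exists_normal_form (g : BS q) :
    ∃ (n : ℕ) (m k : ℤ), g = (a q ^ n)⁻¹ * b q ^ m * a q ^ k := by
  have b_zpow_mul (j : ℤ) (n : ℕ) (m k : ℤ) : b q ^ j * ((a q ^ n)⁻¹ * b q ^ m * a q ^ k) =
      (a q ^ n)⁻¹ * b q ^ (q ^ n * j + m) * a q ^ k := by
    simp only [← mul_assoc, b_zpow_mul_inv_a_pow, zpow_add]
  have hg : g ∈ Subgroup.closure {a q, b q} := closure_a_b q ▸ Subgroup.mem_top g
  induction hg using Subgroup.closure_induction_left with
  | one => exact ⟨0, 0, 0, by simp⟩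
  | mul_left x hx g _ ih =>
    obtain ⟨n, m, k, rfl⟩ := ih
    rcases hx with rfl | rfl
    · cases n with
      | zero =>
        refine ⟨0, q * m, k + 1, ?_⟩
        simp only [pow_zero, inv_one, one_mul, ← mul_assoc, a_mul_b_zpow, add_comm k, zpow_one_add]
      | succ n =>
        refine ⟨n, m, k, ?_⟩
        simp only [pow_succ, mul_inv_rev, ← mul_assoc, mul_inv_cancel, one_mul]
    · exact ⟨n, _, k, by simpa using b_zpow_mul 1 n m k⟩
  | inv_mul_cancel x hx g _ ih =>
    obtain ⟨n, m, k, rfl⟩ := ih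
    rcases hx with rfl | rfl
    · exact ⟨n + 1, m, k, by simp only [pow_succ, mul_inv_rev, mul_assoc]⟩
    · exact ⟨n, _, k, by simpa using b_zpow_mul (-1) n m k⟩

/-- The homomorphism `BS(1, q) → ℤ` with `a ↦ 1` and `b ↦ 0`. -/
def heightHom : BS q →* Multiplicative ℤ :=
  PresentedGroup.toGroup (f := fun x => match x with
    | .a => Multiplicative.ofAdd 1
    | .b => 1) (by
      rintro r rfl
      simp [bsRel])

variable {q}

/-- The height of an element: the total exponent of `a` in any word representing it. -/
def height (g : BS q) : ℤ := (heightHom q g).toAdd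

@[simp] theorem height_one : height (1 : BS q) = 0 := by simp [height]

@[simp] theorem height_mul (g h : BS q) : height (g * h) = height g + height h := by simp [height]

@[simp] theorem height_inv (g : BS q) : height g⁻¹ = -height g := by simp [height]

@[simp] theorem height_pow (g : BS q) (n : ℕ) : height (g ^ n) = n * height g := by simp [height]

@[simp] theorem height_zpow (g : BS q) (n : ℤ) : height (g ^ n) = n * height g := by simp [height]

@[simp] theorem height_a : height (a q) = 1 := by simp [height, a, heightHom]

@[simp] theorem height_b : height (b q) = 0 := by simp [height, b, heightHom]

theorem mem_ker_heightHom {g : BS q} : g ∈ (heightHom q).ker ↔ height g = 0 := by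
  rw [MonoidHom.mem_ker, height, toAdd_eq_zero]

section NeZero

variable [NeZero q]

theorem cast_ne_zero : (q : ℝ) ≠ 0 := Int.cast_ne_zero.mpr (NeZero.ne q)

/-- The action of `BS(1, q)` on `ℝ` by affine maps for `q ≠ 0`, with `a : x ↦ q x` and
`b : x ↦ x + 1`. For `q < 0` it does not preserve the order of `ℝ`. -/
noncomputable def affine (q : ℤ) [NeZero q] : BS q →* Equiv.Perm ℝ :=
  PresentedGroup.toGroup (f := fun x => match x with
    | .a => Equiv.mulLeft₀ (q : ℝ) cast_ne_zero
    | .b => Equiv.addRight (1 : ℝ)) (by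
      rintro r rfl
      simp only [bsRel, map_mul, map_inv, map_zpow, FreeGroup.lift_apply_of]
      rw [mul_inv_eq_one, mul_inv_eq_iff_eq_mul, Equiv.zsmul_addRight]
      ext x
      simp [mul_add])

theorem affine_a (x : ℝ) : affine q (a q) x = q * x := by simp [affine, a]

theorem affine_b (x : ℝ) : affine q (b q) x = x + 1 := by simp [affine, b]

/-- The translation part of the affine map given by an element of `BS(1, q)`. -/
noncomputable def translation (g : BS q) : ℝ := affine q g 0

theorem affine_apply (g : BS q) (x : ℝ) :
    affine q g x = (q : ℝ) ^ height g * x + translation g := by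
  have hq : (q : ℝ) ≠ 0 := cast_ne_zero
  have hg : g ∈ Subgroup.closure {a q, b q} := closure_a_b q ▸ Subgroup.mem_top g
  unfold translation
  induction hg using Subgroup.closure_induction generalizing x with
  | mem g hg => rcases hg with rfl | rfl <;> simp [affine_a, affine_b]
  | one => simp
  | mul g h _ _ ihg ihh =>
    simp only [map_mul, Equiv.Perm.mul_apply, height_mul, zpow_add₀ hq]
    rw [ihg (affine q h x), ihg (affine q h 0), ihh x]
    ring
  | inv g _ ih =>
    have hinv : affine q g⁻¹ 0 = -((q : ℝ) ^ (-height g) * affine q g 0) := by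
      rw [map_inv, Equiv.Perm.inv_eq_iff_eq, ih, zpow_neg]
      field_simp
      ring
    rw [hinv, map_inv, Equiv.Perm.inv_eq_iff_eq, ih, height_inv, zpow_neg]
    field_simp
    ring

theorem affine_sub_affine (g : BS q) (x y : ℝ) :
    affine q g x - affine q g y = (q : ℝ) ^ height g * (x - y) := by
  rw [affine_apply, affine_apply]
  ring

@[simp] theorem translation_one : translation (1 : BS q) = 0 := by simp [translation]

@[simp] theorem translation_b : translation (b q) = 1 := by simp [translation, affine_b]

theorem translation_mul (g h : BS q) :
    translation (g * h) = translation g + (q : ℝ) ^ height g * translation h := by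
  rw [translation, map_mul, Equiv.Perm.mul_apply, affine_apply, add_comm, translation.eq_1 h]

theorem translation_inv (g : BS q) :
    translation g⁻¹ = -((q : ℝ) ^ (-height g) * translation g) := by
  have h := translation_mul g⁻¹ g
  rw [inv_mul_cancel, translation_one, height_inv] at h
  linarith

@[simp] theorem translation_a_zpow (k : ℤ) : translation (a q ^ k) = 0 := by
  rw [translation, map_zpow]
  exact Equiv.Perm.zpow_apply_eq_self_of_apply_eq_self (by simp [affine_a]) k

@[simp] theorem translation_a_pow (k : ℕ) : translation (a q ^ k) = 0 :=
  mod_cast translation_a_zpow (q := q) k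

theorem translation_zpow_of_height_eq_zero {s : BS q} (hs : height s = 0) (n : ℤ) :
    translation (s ^ n) = n * translation s := by
  induction n with
  | zero => simp
  | succ n ih =>
    rw [zpow_add_one, translation_mul, ih]
    simp [hs, add_mul]
  | pred n ih =>
    rw [zpow_sub_one, translation_mul, ih, translation_inv, height_zpow, hs, mul_zero, neg_zero,
      zpow_zero]
    push_cast
    ring

@[simp] theorem translation_b_zpow (m : ℤ) : translation (b q ^ m) = m := by
  simp [translation_zpow_of_height_eq_zero]

theorem translation_inv_mul_of_height_eq_zero {s : BS q} (hs : height s = 0) (t : BS q) :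
    translation (s⁻¹ * t) = translation t - translation s := by
  rw [translation_mul, translation_inv, height_inv, hs, neg_zero, zpow_zero]
  ring

theorem translation_conj (g : BS q) {s : BS q} (hs : height s = 0) :
    translation (g * s * g⁻¹) = (q : ℝ) ^ height g * translation s := by
  have hq := zpow_ne_zero (height g) (cast_ne_zero (q := q))
  rw [translation_mul, translation_mul, translation_inv, height_mul, hs, add_zero, zpow_neg]
  field_simp
  ring

theorem translation_normal_form (n : ℕ) (m k : ℤ) :
    translation ((a q ^ n)⁻¹ * b q ^ m * a q ^ k) = (q : ℝ) ^ (-(n : ℤ)) * m := by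
  rw [translation_mul, translation_mul, translation_inv]
  simp

omit [NeZero q] in
theorem height_normal_form (n : ℕ) (m k : ℤ) :
    height ((a q ^ n)⁻¹ * b q ^ m * a q ^ k) = k - n := by
  simp [neg_add_eq_sub]

theorem eq_one_of_height_of_translation {g : BS q} (hh : height g = 0) (ht : translation g = 0) :
    g = 1 := by
  obtain ⟨n, m, k, rfl⟩ := exists_normal_form q g
  rw [height_normal_form, sub_eq_zero] at hh
  rw [translation_normal_form, mul_eq_zero, or_iff_right (zpow_ne_zero _ cast_ne_zero),
    Int.cast_eq_zero] at ht
  simp [hh, ht]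

theorem ext_height_translation {g h : BS q} (hh : height g = height h)
    (ht : translation g = translation h) : g = h := by
  refine inv_mul_eq_one.mp (eq_one_of_height_of_translation (by simp [hh]) ?_)
  rw [translation_mul, translation_inv, height_inv, hh, ht]
  ring

theorem commute_of_height_eq_zero {s t : BS q} (hs : height s = 0) (ht : height t = 0) :
    Commute s t :=
  ext_height_translation (by simp [hs, ht]) (by simp [translation_mul, hs, ht, add_comm])

theorem exists_translation_eq (g : BS q) :
    ∃ (n : ℕ) (m : ℤ), translation g = (q : ℝ) ^ (-(n : ℤ)) * m := by
  obtain ⟨n, m, k, rfl⟩ := exists_normal_form q g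
  exact ⟨n, m, translation_normal_form n m k⟩

theorem bsAffine_apply (hq : 0 < q) (g : BS q) (x : ℝ) : bsAffine q hq g x = affine q g x := by
  let forgetOrder : (ℝ ≃o ℝ) →* Equiv.Perm ℝ :=
    { toFun := fun e => e.toEquiv
      map_one' := rfl
      map_mul' := fun _ _ => rfl }
  have h : forgetOrder.comp (bsAffine q hq) = affine q := PresentedGroup.ext fun y => by
    cases y <;> ext x <;> simp [bsAffine, bsAffineGen, affine] <;> rfl
  exact DFunLike.congr_fun (DFunLike.congr_fun h g) x

end NeZero

end BS

/-! ### Regular languages and rational subsets of groups -/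

section RegularLanguage

variable {X : Type*} {L M : Language X}

open scoped Computability

theorem isRegular_singleton (w : List X) : Language.IsRegular {w} := by
  rw [Language.isRegular_iff_finite_range_leftQuotient]
  refine ((w.tails.finite_toSet.image fun v => ({v} : Language X)).insert 0).subset ?_
  rintro _ ⟨u, rfl⟩
  by_cases h : u <+: w
  · obtain ⟨v, rfl⟩ := h
    exact Or.inr ⟨v, by simp, Language.ext fun y => (List.append_right_inj u).symm⟩
  · exact Or.inl (Language.ext fun y => ⟨fun hy => h ⟨y, hy⟩, fun hy => hy.elim⟩)

theorem leftQuotient_mul (u : List X) : (L * M).leftQuotient u =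
    L.leftQuotient u * M + ⨆ T ∈ {T | ∃ x ∈ L, ∃ y, x ++ y = u ∧ M.leftQuotient y = T}, T := by
  ext v
  simp only [Language.mem_add, Language.mem_mul, Language.mem_iSup, Language.mem_leftQuotient,
    Set.mem_ofPred_eq]
  constructor
  · rintro ⟨x, hx, y, hy, h⟩
    rcases List.append_eq_append_iff.mp h with ⟨z, rfl, rfl⟩ | ⟨z, rfl, rfl⟩
    · exact Or.inr ⟨_, ⟨x, hx, z, rfl, rfl⟩, hy⟩
    · exact Or.inl ⟨z, hx, y, hy, rfl⟩
  · rintro (⟨x, hx, y, hy, rfl⟩ | ⟨_, ⟨x, hx, y, rfl, rfl⟩, hv⟩)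
    · exact ⟨u ++ x, hx, y, hy, by simp⟩
    · exact ⟨x, hx, y ++ v, hv, by simp⟩

theorem isRegular_mul (hL : L.IsRegular) (hM : M.IsRegular) : (L * M).IsRegular := by
  rw [Language.isRegular_iff_finite_range_leftQuotient] at *
  refine ((hL.prod hM.finite_subsets).image fun p => p.1 * M + ⨆ T ∈ p.2, T).subset ?_
  rintro _ ⟨u, rfl⟩
  refine ⟨(_, _), ⟨⟨u, rfl⟩, ?_⟩, (leftQuotient_mul u).symm⟩
  rintro _ ⟨_, -, y, -, rfl⟩
  exact ⟨y, rfl⟩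

theorem append_mem_kstar_iff {u v : List X} : u ++ v ∈ L∗ ↔
    ∃ x ∈ L∗, ∃ y, x ++ y = u ∧ ∃ z t, z ++ t = v ∧ t ∈ L∗ ∧ (y = [] ∧ z = [] ∨ y ++ z ∈ L) := by
  constructor
  · rintro ⟨W, hW, hL⟩
    rcases List.flatten_eq_append_iff.mp hW.symm with
      ⟨V, V', rfl, rfl, rfl⟩ | ⟨V, y, c, z, V', rfl, rfl, rfl⟩
    · exact ⟨V.flatten, Language.join_mem_kstar fun w hw => hL w (by simp [hw]), [], by simp, [],
        V'.flatten, rfl, Language.join_mem_kstar fun w hw => hL w (by simp [hw]), Or.inl ⟨rfl, rfl⟩⟩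
    · exact ⟨_, Language.join_mem_kstar fun w hw => hL w (by simp [hw]), y, rfl, c :: z, _,
        rfl, Language.join_mem_kstar fun w hw => hL w (by simp [hw]), Or.inr (hL _ (by simp))⟩
  · rintro ⟨x, hx, y, rfl, z, t, rfl, ht, hyz⟩
    have hyz' : y ++ z ∈ L∗ := by
      rcases hyz with ⟨rfl, rfl⟩ | hyz
      · exact Language.nil_mem_kstar L
      · exact le_kstar (a := L) hyz
    have h := Language.append_mem_mul (Language.append_mem_mul hx hyz') ht
    rw [kstar_mul_kstar, kstar_mul_kstar] at h
    simpa using h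

theorem leftQuotient_kstar (u : List X) : L∗.leftQuotient u =
    (⨆ T ∈ {T | ∃ x ∈ L∗, ∃ y, x ++ y = u ∧ (y = [] ∧ T = 1 ∨ L.leftQuotient y = T)}, T) * L∗ := by
  ext v
  simp only [Language.mem_mul, Language.mem_iSup, Language.mem_leftQuotient, Set.mem_ofPred_eq,
    append_mem_kstar_iff]
  constructor
  · rintro ⟨x, hx, y, rfl, z, t, rfl, ht, ⟨rfl, rfl⟩ | hyz⟩
    · exact ⟨[], ⟨1, ⟨x, hx, [], rfl, Or.inl ⟨rfl, rfl⟩⟩, rfl⟩, t, ht, rfl⟩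
    · exact ⟨z, ⟨_, ⟨x, hx, y, rfl, Or.inr rfl⟩, hyz⟩, t, ht, rfl⟩
  · rintro ⟨z, ⟨_, ⟨x, hx, y, rfl, ⟨rfl, rfl⟩ | rfl⟩, hz⟩, t, ht, rfl⟩
    · exact ⟨x, hx, [], rfl, z, t, rfl, ht, Or.inl ⟨rfl, hz⟩⟩
    · exact ⟨x, hx, y, rfl, z, t, rfl, ht, Or.inr hz⟩

theorem isRegular_kstar (hL : L.IsRegular) : L∗.IsRegular := by
  rw [Language.isRegular_iff_finite_range_leftQuotient] at *
  refine ((hL.insert 1).finite_subsets.image fun S => (⨆ T ∈ S, T) * L∗).subset ?_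
  rintro _ ⟨u, rfl⟩
  refine ⟨_, ?_, (leftQuotient_kstar u).symm⟩
  rintro T ⟨_, -, y, -, ⟨-, rfl⟩ | rfl⟩
  · exact Set.mem_insert 1 _
  · exact Set.mem_insert_of_mem _ ⟨y, rfl⟩

end RegularLanguage

section Rational

variable {X G : Type*} [Group G] {π : FreeMonoid X →* G} {S T : Set G}

open scoped Computability Pointwise

/-- A subset of a group is rational if it is the image of a regular language under `π`. -/
abbrev IsRational (π : FreeMonoid X →* G) (S : Set G) : Prop :=
  IsRepresentedBy Language.IsRegular π S

/-- The powers of `g` with positive exponent. -/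
def positivePowers (g : G) : Set G := {h | ∃ n : ℤ, 0 < n ∧ g ^ n = h}

theorem positivePowers_eq_mul_powers (g : G) :
    positivePowers g = {g} * (Submonoid.powers g : Set G) := by
  ext h
  simp only [positivePowers, Set.mem_ofPred_eq, Set.singleton_mul, Set.mem_image, SetLike.mem_coe,
    Submonoid.mem_powers_iff, exists_exists_eq_and, ← pow_succ']
  constructor
  · rintro ⟨n, hn, rfl⟩
    lift n to ℕ using hn.le
    exact ⟨n - 1, by rw [Nat.sub_add_cancel (by exact_mod_cast hn), zpow_natCast]⟩
  · rintro ⟨n, rfl⟩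
    exact ⟨n + 1, by positivity, by exact_mod_cast zpow_natCast g (n + 1)⟩

theorem isRational_singleton (hπ : Function.Surjective π) (g : G) : IsRational π {g} := by
  obtain ⟨w, rfl⟩ := hπ g
  refine ⟨_, isRegular_singleton w.toList, ?_⟩
  ext g
  constructor
  · rintro ⟨_, rfl, rfl⟩
    rfl
  · rintro rfl
    exact ⟨_, rfl, rfl⟩

theorem IsRational.union (hS : IsRational π S) (hT : IsRational π T) : IsRational π (S ∪ T) := by
  obtain ⟨L, hL, rfl⟩ := hS
  obtain ⟨M, hM, rfl⟩ := hT
  refine ⟨L + M, hL.add hM, ?_⟩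
  ext g
  simp only [Language.mem_add, Set.mem_ofPred_eq, Set.mem_union, or_and_right, exists_or]

theorem IsRational.mul (hS : IsRational π S) (hT : IsRational π T) : IsRational π (S * T) := by
  obtain ⟨L, hL, rfl⟩ := hS
  obtain ⟨M, hM, rfl⟩ := hT
  refine ⟨L * M, isRegular_mul hL hM, ?_⟩
  ext g
  constructor
  · rintro ⟨_, ⟨x, hx, y, hy, rfl⟩, rfl⟩
    exact ⟨_, ⟨x, hx, rfl⟩, _, ⟨y, hy, rfl⟩, by simp⟩
  · rintro ⟨_, ⟨x, hx, rfl⟩, _, ⟨y, hy, rfl⟩, rfl⟩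
    exact ⟨_, ⟨x, hx, y, hy, rfl⟩, by simp⟩

theorem IsRational.submonoidClosure (hS : IsRational π S) :
    IsRational π (Submonoid.closure S : Set G) := by
  obtain ⟨L, hL, rfl⟩ := hS
  refine ⟨L∗, isRegular_kstar hL, ?_⟩
  ext g
  constructor
  · rintro ⟨_, ⟨W, rfl, hW⟩, rfl⟩
    rw [FreeMonoid.ofList_flatten, map_list_prod]
    refine Submonoid.list_prod_mem _ ?_
    simp only [List.map_map, List.mem_map, Function.comp_apply, forall_exists_index, and_imp,
      forall_apply_eq_imp_iff₂]
    exact fun w hw => Submonoid.subset_closure ⟨w, hW w hw, rfl⟩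
  · intro hg
    induction hg using Submonoid.closure_induction with
    | mem g h =>
      obtain ⟨w, hw, rfl⟩ := h
      exact ⟨w, le_kstar (a := L) hw, rfl⟩
    | one => exact ⟨[], Language.nil_mem_kstar L, map_one π⟩
    | mul g h _ _ ihg ihh =>
      obtain ⟨v, hv, rfl⟩ := ihg
      obtain ⟨w, hw, rfl⟩ := ihh
      exact ⟨v ++ w, kstar_mul_kstar L ▸ Language.append_mem_mul hv hw, by simp⟩

theorem isRational_powers (hπ : Function.Surjective π) (g : G) :
    IsRational π (Submonoid.powers g : Set G) := by
  rw [Submonoid.powers_eq_closure]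
  exact (isRational_singleton hπ g).submonoidClosure

theorem isRational_zpowers (hπ : Function.Surjective π) (g : G) :
    IsRational π (Subgroup.zpowers g : Set G) := by
  rw [Subgroup.zpowers_eq_closure, ← Subgroup.coe_toSubmonoid, Subgroup.closure_toSubmonoid,
    Set.inv_singleton]
  exact ((isRational_singleton hπ g).union (isRational_singleton hπ g⁻¹)).submonoidClosure

theorem isRational_positivePowers (hπ : Function.Surjective π) (g : G) :
    IsRational π (positivePowers g) := by
  rw [positivePowers_eq_mul_powers]
  exact (isRational_singleton hπ g).mul (isRational_powers hπ g)

end Rational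

/-! ### Regular left-orders on `BS(1, q)` for `q ≥ -1` -/

namespace BS

variable {q : ℤ}

open scoped Pointwise

section NeZero

variable [NeZero q]

/-- The positive cone of the left-order on `BS(1, q)`, `q > 0`, in which the translation part
dominates the height. -/
def translationCone (q : ℤ) [NeZero q] : Set (BS q) := lexCone translation height

/-- The positive cone of the left-order on `BS(1, q)`, `q ≠ 0`, in which the height dominates the
translation part. -/
def heightCone (q : ℤ) [NeZero q] : Set (BS q) := lexCone height translation

theorem isPositiveCone_translationCone (hq : 0 < q) : IsPositiveCone (translationCone q) :=
  isPositiveCone_lexCone (fun g => zpow_pos (Int.cast_pos.mpr hq) (height g)) translation_mul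
    (fun g h _ _ => height_mul g h) fun _ ht hh => eq_one_of_height_of_translation hh ht

theorem isPositiveCone_heightCone (q : ℤ) [NeZero q] : IsPositiveCone (heightCone q) :=
  isPositiveCone_lexCone (c := fun _ => 1) (fun _ => one_pos) (fun g h => by simp)
    (fun g h hg _ => by simp [translation_mul, hg]) fun _ => eq_one_of_height_of_translation

theorem positivePowers_a (q : ℤ) [NeZero q] :
    positivePowers (a q) = {g | translation g = 0 ∧ 0 < height g} := by
  ext g
  constructor
  · rintro ⟨k, hk, rfl⟩
    simpa using hk
  · rintro ⟨ht, hh⟩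
    exact ⟨height g, hh, ext_height_translation (by simp) (by simp [ht])⟩

theorem translationCone_eq (hq : 0 < q) : translationCone q =
    (Submonoid.powers (a q)⁻¹ : Set (BS q)) * positivePowers (b q) *
      (Subgroup.zpowers (a q) : Set (BS q)) ∪ positivePowers (a q) := by
  have hpow (n : ℕ) : 0 < (q : ℝ) ^ (-(n : ℤ)) := zpow_pos (Int.cast_pos.mpr hq) _
  have hset : {g : BS q | 0 < translation g} = (Submonoid.powers (a q)⁻¹ : Set (BS q)) *
      positivePowers (b q) * (Subgroup.zpowers (a q) : Set (BS q)) := by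
    ext g
    constructor
    · intro hg
      obtain ⟨n, m, k, rfl⟩ := exists_normal_form q g
      rw [Set.mem_ofPred_eq, translation_normal_form, mul_pos_iff_of_pos_left (hpow n),
        Int.cast_pos] at hg
      exact Set.mul_mem_mul (Set.mul_mem_mul ⟨n, inv_pow _ n⟩ ⟨m, hg, rfl⟩) ⟨k, rfl⟩
    · rintro ⟨_, ⟨_, ⟨n, rfl⟩, _, ⟨m, hm, rfl⟩, rfl⟩, _, ⟨k, rfl⟩, rfl⟩
      simp only [Set.mem_ofPred_eq, inv_pow, translation_normal_form]
      exact mul_pos (hpow n) (Int.cast_pos.mpr hm)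
  rw [← hset, positivePowers_a]
  rfl

omit [NeZero q] in
theorem exists_eq_b_zpow_mul_a_zpow_height (hq : q * q = 1) (g : BS q) :
    ∃ m : ℤ, g = b q ^ m * a q ^ height g := by
  obtain ⟨n, m, k, rfl⟩ := exists_normal_form q g
  have hmul : q ^ n * (q ^ n * m) = m := by rw [← mul_assoc, ← mul_pow, hq, one_pow, one_mul]
  refine ⟨q ^ n * m, ?_⟩
  rw [height_normal_form, sub_eq_neg_add, zpow_add, zpow_neg, zpow_natCast, ← mul_assoc,
    b_zpow_mul_inv_a_pow, hmul]

theorem heightCone_eq (hq : q * q = 1) : heightCone q = positivePowers (b q) ∪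
    (Subgroup.zpowers (b q) : Set (BS q)) * positivePowers (a q) := by
  have hb (m : ℤ) (g : BS q) (hg : translation g = 0) : translation (b q ^ m * g) = m := by
    simp [translation_mul, hg]
  ext g
  constructor
  · obtain ⟨m, hm⟩ := exists_eq_b_zpow_mul_a_zpow_height hq g
    rintro (hpos | ⟨hzero, hpos⟩)
    · rw [hm]
      exact Or.inr (Set.mul_mem_mul ⟨m, rfl⟩ ⟨_, hpos, rfl⟩)
    · rw [hm, hb _ _ (translation_a_zpow _), Int.cast_pos] at hpos
      exact Or.inl ⟨m, hpos, by rw [hm, hzero, zpow_zero, mul_one]⟩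
  · rintro (⟨m, hm, rfl⟩ | ⟨_, ⟨m, rfl⟩, _, ⟨k, hk, rfl⟩, rfl⟩)
    · exact Or.inr (by simpa using hm)
    · exact Or.inl (by simpa using hk)

end NeZero

theorem eq_a_zpow_height (g : BS 0) : g = a 0 ^ height g := by
  have hb : b 0 = 1 := by simpa using a_mul_b 0
  obtain ⟨n, m, k, rfl⟩ := exists_normal_form 0 g
  rw [height_normal_form, hb, one_zpow, mul_one, sub_eq_neg_add, zpow_add, zpow_neg, zpow_natCast]

theorem isPositiveCone_positivePowers_a_zero : IsPositiveCone (positivePowers (a 0)) where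
  mul_mem := by
    rintro _ _ ⟨m, hm, rfl⟩ ⟨n, hn, rfl⟩
    exact ⟨m + n, add_pos hm hn, zpow_add _ m n⟩
  one_notMem := by
    rintro ⟨n, hn, h⟩
    exact hn.ne' (by simpa using congrArg height h)
  mem_or_inv_mem {g} hg := by
    have hne : height g ≠ 0 := fun h => hg (by rw [eq_a_zpow_height g, h, zpow_zero])
    rcases hne.lt_or_gt with hneg | hpos
    · refine Or.inr ⟨-height g, neg_pos.mpr hneg, ?_⟩
      rw [zpow_neg, ← eq_a_zpow_height]
    · exact Or.inl ⟨height g, hpos, (eq_a_zpow_height g).symm⟩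

theorem exists_isRegularLeftOrder {X : Type*} {π : FreeMonoid X →* BS q}
    (hπ : Function.Surjective π) (hq : -1 ≤ q) :
    ∃ lt : BS q → BS q → Prop, IsRegularLeftOrder π lt := by
  suffices ∃ P : Set (BS q), IsPositiveCone P ∧ IsRational π P by
    obtain ⟨P, hP, hrat⟩ := this
    exact ⟨_, hP.isLeftOrder, by rwa [posCone_inv_mul_mem]⟩
  obtain hpos | rfl | hneg : 0 < q ∨ q = 0 ∨ q = -1 := by omega
  · have : NeZero q := ⟨hpos.ne'⟩
    refine ⟨translationCone q, isPositiveCone_translationCone hpos, ?_⟩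
    rw [translationCone_eq hpos]
    exact (((isRational_powers hπ _).mul (isRational_positivePowers hπ _)).mul
      (isRational_zpowers hπ _)).union (isRational_positivePowers hπ _)
  · exact ⟨_, isPositiveCone_positivePowers_a_zero, isRational_positivePowers hπ _⟩
  · have : NeZero q := ⟨by omega⟩
    refine ⟨heightCone q, isPositiveCone_heightCone q, ?_⟩
    rw [heightCone_eq (by rw [hneg]; rfl)]
    exact (isRational_positivePowers hπ _).union
      ((isRational_zpowers hπ _).mul (isRational_positivePowers hπ _))

end BS

/-! ### Regular left-orders are not dominated by the height if `2 ≤ |q|` -/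

section RegularLanguage

variable {X : Type*} {L : Language X}

theorem exists_finite_suffixes_of_isRegular (hL : L.IsRegular) :
    ∃ V : Set (List X), V.Finite ∧ ∀ u v, u ++ v ∈ L → ∃ v' ∈ V, u ++ v' ∈ L := by
  choose! f hf using fun (T : Language X) (hT : ∃ v, v ∈ T) => hT
  exact ⟨_, hL.finite_range_leftQuotient.image f,
    fun u v huv => ⟨_, ⟨_, ⟨u, rfl⟩, rfl⟩, hf (L.leftQuotient u) ⟨v, huv⟩⟩⟩

theorem exists_finite_prefixes_of_isRegular (hL : L.IsRegular) :
    ∃ U : Set (List X), U.Finite ∧ ∀ u v, u ++ v ∈ L → ∃ u' ∈ U, u' ++ v ∈ L := by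
  choose! f hf using fun (T : Language X) (hT : T ∈ Set.range L.leftQuotient) => hT
  exact ⟨_, hL.finite_range_leftQuotient.image f, fun u v huv =>
    ⟨_, ⟨_, ⟨u, rfl⟩, rfl⟩, (hf _ ⟨u, rfl⟩).ge huv⟩⟩

theorem exists_abs_le_of_isRegular {A : Type*} [AddCommGroup A] [LinearOrder A]
    [IsOrderedAddMonoid A] (hL : L.IsRegular) {f : List X → A}
    (f_append : ∀ u v, f (u ++ v) = f u + f v) (f_nonneg : ∀ w ∈ L, 0 ≤ f w) :
    ∃ C, ∀ u v, u ++ v ∈ L → f (u ++ v) = 0 → |f u| ≤ C := by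
  obtain ⟨V, hV, hLV⟩ := exists_finite_suffixes_of_isRegular hL
  obtain ⟨U, hU, hLU⟩ := exists_finite_prefixes_of_isRegular hL
  obtain ⟨C, hC⟩ := ((hV.union hU).image fun w => |f w|).bddAbove
  refine ⟨C, fun u v huv hzero => abs_le.mpr ⟨?_, ?_⟩⟩
  · obtain ⟨v', hv', huv'⟩ := hLV u v huv
    calc -C ≤ -f v' := neg_le_neg ((le_abs_self _).trans (hC ⟨v', Or.inl hv', rfl⟩))
      _ ≤ f u := by rw [neg_le_iff_add_nonneg, ← f_append]; exact f_nonneg _ huv'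
  · obtain ⟨u', hu', huv'⟩ := hLU u v huv
    calc f u = -f v := eq_neg_of_add_eq_zero_left (by rw [← f_append, hzero])
      _ ≤ f u' := by rw [neg_le_iff_add_nonneg, ← f_append]; exact f_nonneg _ huv'
      _ ≤ C := (le_abs_self _).trans (hC ⟨u', Or.inr hu', rfl⟩)

end RegularLanguage

namespace BS

variable {q : ℤ}

/-- The lattice `q⁻ᴺ ℤ` in `ℝ`. -/
noncomputable def lattice (q N : ℤ) : AddSubgroup ℝ := AddSubgroup.zmultiples ((q : ℝ) ^ (-N))

section NeZero

variable [NeZero q]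

theorem lattice_mono : Monotone (lattice q) := by
  intro M N hMN
  obtain ⟨k, rfl⟩ := Int.le.dest hMN
  have hk : (q : ℝ) ^ k ≠ 0 := pow_ne_zero k cast_ne_zero
  refine AddSubgroup.zmultiples_le_of_mem ⟨q ^ k, ?_⟩
  simp [zpow_add₀ (cast_ne_zero (q := q)), mul_inv_cancel_left₀ hk]

theorem zpow_mul_mem_lattice {N : ℤ} {x : ℝ} (hx : x ∈ lattice q N) (k : ℤ) :
    (q : ℝ) ^ k * x ∈ lattice q (N - k) := by
  obtain ⟨m, rfl⟩ := hx
  exact ⟨m, by simp [sub_eq_add_neg, zpow_add₀ (cast_ne_zero (q := q)), mul_left_comm]⟩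

theorem exists_translation_mem_lattice (g : BS q) : ∃ N, translation g ∈ lattice q N := by
  obtain ⟨n, m, hg⟩ := exists_translation_eq g
  exact ⟨n, m, by simp [hg, mul_comm]⟩

theorem exists_translation_notMem_lattice (hq : 2 ≤ |q|) (N : ℤ) :
    ∃ g : BS q, height g = 0 ∧ translation g ∉ lattice q N := by
  let n := N.toNat
  refine ⟨(a q ^ (n + 1))⁻¹ * b q ^ (1 : ℤ) * a q ^ ((n + 1 : ℕ) : ℤ), ?_, fun hmem => ?_⟩
  · rw [height_normal_form, sub_self]
  · have hone : (1 : ℝ) ∈ lattice q (-1) := by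
      have h := zpow_mul_mem_lattice (lattice_mono N.self_le_toNat hmem) (n + 1 : ℕ)
      rw [translation_normal_form, zpow_neg, mul_inv_cancel_left₀ (zpow_ne_zero _ cast_ne_zero),
        Int.cast_one] at h
      simpa [n] using h
    obtain ⟨m, hm⟩ := hone
    have hmq : m * q = 1 := by
      simpa [← Int.cast_mul] using hm
    have := Int.isUnit_iff_abs_eq.mp (IsUnit.of_mul_eq_one_right m hmq)
    omega

variable {X : Type*} {π : FreeMonoid X →* BS q} {lt : BS q → BS q → Prop}

theorem translation_mem_lattice_of_neg_le_height {C D : ℤ}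
    (hD : ∀ x, translation (π (FreeMonoid.of x)) ∈ lattice q D) {w : List X}
    (hw : ∀ u, u <+: w → -C ≤ height (π (FreeMonoid.ofList u))) :
    translation (π (FreeMonoid.ofList w)) ∈ lattice q (D + C) := by
  induction w using List.reverseRecOn with
  | nil => simp
  | append_singleton w x ih =>
    rw [FreeMonoid.ofList_append, map_mul, translation_mul]
    have hheight := hw w (List.prefix_append w [x])
    exact add_mem (ih fun u hu => hw u (hu.trans (List.prefix_append w [x])))
      (lattice_mono (by omega) (zpow_mul_mem_lattice (hD x) _))

theorem exists_translation_mem_lattice_of_one_lt [Finite X] (H : IsRegularLeftOrder π lt)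
    (hdom : DominatedBy lt (heightHom q)) :
    ∃ N, ∀ g, height g = 0 → lt 1 g → translation g ∈ lattice q N := by
  obtain ⟨H, L, hL, hP⟩ := H
  obtain ⟨ε, hε⟩ := hdom
  let f : List X → ℤ := fun w => ε * height (π (FreeMonoid.ofList w))
  have f_append (u v : List X) : f (u ++ v) = f u + f v := by simp [f, mul_add]
  have f_nonneg : ∀ w ∈ L, 0 ≤ f w := by
    intro w hw
    by_contra! hneg
    have hinv : lt 1 (π (FreeMonoid.ofList w))⁻¹ := hε _ (by simpa [f, height] using hneg)
    exact H.asymm ((H.lt_one_iff _).mpr hinv) (hP.subset ⟨w, hw, rfl⟩)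
  obtain ⟨C, hC⟩ := exists_abs_le_of_isRegular hL f_append f_nonneg
  choose N hN using fun x => exists_translation_mem_lattice (π (FreeMonoid.of x))
  obtain ⟨D, hD⟩ := Finite.exists_le N
  refine ⟨D + C, fun g hg hlt => ?_⟩
  obtain ⟨w, hw, rfl⟩ := hP.superset hlt
  refine translation_mem_lattice_of_neg_le_height (fun x => lattice_mono (hD x) (hN x)) ?_
  rintro u ⟨v, rfl⟩
  have hu := hC u v hw (by simp only [f, hg, mul_zero])
  rw [abs_mul, Int.isUnit_iff_abs_eq.mp ε.isUnit, one_mul] at hu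
  exact (abs_le.mp hu).1

theorem not_dominatedBy_heightHom_of_isRegularLeftOrder [Finite X] (hq : 2 ≤ |q|)
    (H : IsRegularLeftOrder π lt) : ¬ DominatedBy lt (heightHom q) := by
  intro hdom
  obtain ⟨N, hN⟩ := exists_translation_mem_lattice_of_one_lt H hdom
  obtain ⟨g, hg, hmem⟩ := exists_translation_notMem_lattice hq N
  rcases H.1.eq_or_lt_or_gt 1 g with rfl | hlt | hlt
  · simp at hmem
  · exact hmem (hN g hg hlt)
  · have hinv := hN g⁻¹ (by simp [hg]) ((H.1.lt_one_iff g).mp hlt)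
    rw [translation_inv, hg, neg_zero, zpow_zero, one_mul] at hinv
    exact hmem (neg_mem_iff.mp hinv)

end NeZero

end BS

/-! ### Left-orders in which the kernel of the height is cofinal -/

theorem IsLeftOrder.lt_mul_of_commute {G : Type*} [Group G] {lt : G → G → Prop}
    (H : IsLeftOrder lt) {s t g h : G} (hst : Commute s t) (htg : lt t g)
    (hh : lt (g⁻¹ * (t⁻¹ * s) * g) h) : lt s (g * h) := by
  refine H.trans (g := t⁻¹ * s * g) ?_ ?_
  · have hs : s = t⁻¹ * s * t := by rw [mul_assoc, hst.eq, inv_mul_cancel_left]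
    conv_lhs => rw [hs]
    exact (H.mul_left_iff _ _ _).mpr htg
  · rw [← H.mul_left_iff g] at hh
    simpa only [← mul_assoc, mul_inv_cancel, one_mul] using hh

namespace BS

variable {q : ℤ} [NeZero q] {lt : BS q → BS q → Prop}

section Height

variable (H : IsLeftOrder lt) (hb : lt 1 (b q))
include H hb

theorem one_lt_of_translation_pos {s : BS q} (hs : height s = 0) (hpos : 0 < translation s) :
    lt 1 s := by
  obtain ⟨n, m, hm⟩ := exists_translation_eq s
  have hqn : (q : ℝ) ^ n ≠ 0 := pow_ne_zero n cast_ne_zero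
  have hqq : 0 < q ^ n * q ^ n := mul_self_pos.mpr (pow_ne_zero n (NeZero.ne q))
  have htrans : ((q ^ n * q ^ n : ℤ) : ℝ) * translation s = (q ^ n * m : ℤ) := by
    rw [hm, zpow_neg, zpow_natCast]
    push_cast
    field_simp
  have hpow : s ^ (q ^ n * q ^ n) = b q ^ (q ^ n * m) := ext_height_translation (by simp [hs])
    (by rw [translation_zpow_of_height_eq_zero hs, translation_b_zpow, htrans])
  have hqm : 0 < q ^ n * m := by
    have : (0 : ℝ) < (q ^ n * m : ℤ) := htrans ▸ mul_pos (Int.cast_pos.mpr hqq) hpos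
    exact_mod_cast this
  rw [← H.one_lt_zpow_iff hqq, hpow]
  exact H.one_lt_zpow hb hqm

theorem lt_iff_translation_lt {s t : BS q} (hs : height s = 0) (ht : height t = 0) :
    lt s t ↔ translation s < translation t := by
  have lt_of_translation_lt {s t : BS q} (hs : height s = 0) (ht : height t = 0)
      (hst : translation s < translation t) : lt s t := by
    rw [H.lt_iff_one_lt]
    refine one_lt_of_translation_pos H hb (by simp [hs, ht]) ?_
    rwa [translation_inv_mul_of_height_eq_zero hs, sub_pos]
  refine ⟨fun hlt => ?_, lt_of_translation_lt hs ht⟩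
  by_contra! hle
  rcases hle.lt_or_eq with hts | hts
  · exact H.asymm hlt (lt_of_translation_lt ht hs hts)
  · rw [ext_height_translation (hs.trans ht.symm) hts.symm] at hlt
    exact H.irrefl _ hlt

theorem pos_of_cofinalIn (hcof : CofinalIn (heightHom q).ker lt) : 0 < q := by
  obtain ⟨t, ht, hta⟩ := H.exists_mem_lt_of_cofinalIn hcof (a q)
  obtain ⟨u, hu, hau⟩ := hcof (a q)
  rw [mem_ker_heightHom] at ht hu
  by_contra! hq
  have hq1 : (q : ℝ) ≤ -1 := by
    have := NeZero.ne q
    exact_mod_cast (by omega : q ≤ -1)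
  obtain ⟨j, hj⟩ := exists_int_gt (max 0 (translation u - translation t))
  rw [max_lt_iff, Int.cast_pos] at hj
  -- Since `q < 0`, the element `b ^ (-q * j)` moves `t` far up, while `b ^ (-q * j) * a < a`.
  have hlt : lt (b q ^ (q * -j) * t) (a q * b q ^ (-j)) := by
    rwa [a_mul_b_zpow, H.mul_left_iff]
  have hle : lt (a q * b q ^ (-j)) (a q) := by
    rw [H.lt_iff_one_lt]
    simpa using H.one_lt_zpow hb hj.1
  have h := (lt_iff_translation_lt H hb (by simp [ht]) hu).mp (H.trans (H.trans hlt hle) hau)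
  rw [translation_mul, translation_b_zpow, height_zpow, height_b, mul_zero, zpow_zero, one_mul] at h
  push_cast at h
  nlinarith [Int.cast_pos (R := ℝ) |>.mpr hj.1]

end Height

theorem exists_translation_between (hq : 1 < q) {x y : ℝ} (hxy : x < y) :
    ∃ s : BS q, height s = 0 ∧ x < translation s ∧ translation s < y := by
  have hq1 : (1 : ℝ) < q := by exact_mod_cast hq
  obtain ⟨n, hn⟩ := pow_unbounded_of_one_lt (1 / (y - x)) hq1
  have hpos : (0 : ℝ) < (q : ℝ) ^ n := by positivity
  rw [div_lt_iff₀ (sub_pos.mpr hxy)] at hn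
  refine ⟨(a q ^ n)⁻¹ * b q ^ (⌊(q : ℝ) ^ n * x⌋ + 1) * a q ^ (n : ℤ), by simp, ?_⟩
  rw [translation_normal_form, zpow_neg, zpow_natCast, Int.cast_add, Int.cast_one,
    lt_inv_mul_iff₀ hpos, inv_mul_lt_iff₀ hpos]
  have hfloor := Int.floor_le ((q : ℝ) ^ n * x)
  exact ⟨Int.lt_floor_add_one _, by linarith⟩

/-- `c` is the position of `g` with respect to the elements of height `0`, which are identified
with their translation parts. -/
def IsCut (lt : BS q → BS q → Prop) (g : BS q) (c : ℝ) : Prop :=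
  ∀ s, height s = 0 → (translation s < c → lt s g) ∧ (c < translation s → lt g s)

section Cut

variable (H : IsLeftOrder lt) (hb : lt 1 (b q)) {g h : BS q} {c d : ℝ}
include H

include hb in
theorem isCut_translation {s : BS q} (hs : height s = 0) : IsCut lt s (translation s) :=
  fun _ ht => ⟨(lt_iff_translation_lt H hb ht hs).mpr, (lt_iff_translation_lt H hb hs ht).mpr⟩

theorem IsCut.eq (hq : 1 < q) (hc : IsCut lt g c) (hd : IsCut lt g d) : c = d := by
  have not_lt_of_isCut {c d : ℝ} (hc : IsCut lt g c) (hd : IsCut lt g d) : ¬ c < d := fun hcd => by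
    obtain ⟨s, hs, hcs, hsd⟩ := exists_translation_between hq hcd
    exact H.asymm ((hd s hs).1 hsd) ((hc s hs).2 hcs)
  exact le_antisymm (not_lt.mp (not_lt_of_isCut hd hc)) (not_lt.mp (not_lt_of_isCut hc hd))

theorem IsCut.mul (hq : 1 < q) (hc : IsCut lt g c) (hd : IsCut lt h d) :
    IsCut lt (g * h) (c + (q : ℝ) ^ height g * d) := by
  intro s hs
  have hpos : (0 : ℝ) < (q : ℝ) ^ height g := zpow_pos (by exact_mod_cast one_pos.trans hq) _
  have hconj {t : BS q} (ht : height t = 0) : translation (g⁻¹ * (t⁻¹ * s) * g) =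
      ((q : ℝ) ^ height g)⁻¹ * (translation s - translation t) := by
    rw [← translation_inv_mul_of_height_eq_zero ht, ← zpow_neg, ← height_inv,
      ← translation_conj g⁻¹ (by simp [hs, ht]), inv_inv]
  have hheight {t : BS q} (ht : height t = 0) : height (g⁻¹ * (t⁻¹ * s) * g) = 0 := by
    simp [hs, ht]
  constructor
  · intro hlt
    obtain ⟨t, ht, hst, htc⟩ := exists_translation_between hq (sub_lt_iff_lt_add.mpr hlt)
    refine H.lt_mul_of_commute (commute_of_height_eq_zero hs ht) ((hc t ht).1 htc)
      ((hd _ (hheight ht)).1 ?_)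
    rw [hconj ht, inv_mul_lt_iff₀ hpos]
    linarith
  · intro hlt
    obtain ⟨t, ht, hct, hts⟩ := exists_translation_between hq (lt_sub_iff_add_lt.mpr hlt)
    refine H.swap.lt_mul_of_commute (commute_of_height_eq_zero hs ht) ((hc t ht).2 hct)
      ((hd _ (hheight ht)).2 ?_)
    rw [hconj ht, lt_inv_mul_iff₀ hpos]
    linarith

include hb in
theorem exists_isCut (hq : 1 < q) (hcof : CofinalIn (heightHom q).ker lt) (g : BS q) :
    ∃ c, IsCut lt g c := by
  let S : Set ℝ := translation '' {s | height s = 0 ∧ lt s g}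
  have hne : S.Nonempty := by
    obtain ⟨t, ht, htg⟩ := H.exists_mem_lt_of_cofinalIn hcof g
    exact ⟨_, t, ⟨mem_ker_heightHom.mp ht, htg⟩, rfl⟩
  have hbdd : BddAbove S := by
    obtain ⟨u, hu, hgu⟩ := hcof g
    refine ⟨translation u, ?_⟩
    rintro _ ⟨s, ⟨hs, hsg⟩, rfl⟩
    exact ((lt_iff_translation_lt H hb hs (mem_ker_heightHom.mp hu)).mp (H.trans hsg hgu)).le
  refine ⟨sSup S, fun s hs => ⟨fun hlt => ?_, fun hlt => ?_⟩⟩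
  · obtain ⟨_, ⟨t, ⟨ht, htg⟩, rfl⟩, hst⟩ := exists_lt_of_lt_csSup hne hlt
    exact H.trans ((lt_iff_translation_lt H hb hs ht).mpr hst) htg
  · obtain ⟨t, ht, hlt', hts⟩ := exists_translation_between hq hlt
    have hgt : ¬ lt t g := fun htg => hlt'.not_ge (le_csSup hbdd ⟨t, ⟨ht, htg⟩, rfl⟩)
    have hts' := (lt_iff_translation_lt H hb ht hs).mpr hts
    rcases H.eq_or_lt_or_gt g t with rfl | hgt' | htg
    · exact hts'
    · exact H.trans hgt' hts'
    · exact absurd htg hgt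

end Cut

/-- Since `q ≠ 1`, a cocycle agrees at `a` with the displacement of some point `x`. -/
theorem exists_eq_affine_sub_of_cocycle (hq : q ≠ 1) {c : BS q → ℝ}
    (c_mul : ∀ g h, c (g * h) = c g + (q : ℝ) ^ height g * c h) (c_b : c (b q) = 1) :
    ∃ x, ∀ g, c g = affine q g x - x := by
  have hq1 : (q : ℝ) - 1 ≠ 0 := sub_ne_zero.mpr (by exact_mod_cast hq)
  have c_one : c 1 = 0 := by simpa using c_mul 1 1
  refine ⟨c (a q) / (q - 1), fun g => ?_⟩
  have hg : g ∈ Subgroup.closure {a q, b q} := closure_a_b q ▸ Subgroup.mem_top g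
  induction hg using Subgroup.closure_induction with
  | mem g hg =>
    rcases hg with rfl | rfl
    · rw [affine_a]
      field_simp
    · rw [affine_b, c_b]
      ring
  | one => simp [c_one]
  | mul g h _ _ ihg ihh =>
    rw [c_mul, ihg, ihh, map_mul, Equiv.Perm.mul_apply, ← affine_sub_affine]
    ring
  | inv g _ ih =>
    have h := c_mul g⁻¹ g
    rw [inv_mul_cancel, c_one, ih, ← affine_sub_affine, map_inv, Equiv.Perm.inv_def,
      Equiv.symm_apply_apply] at h
    rw [map_inv, Equiv.Perm.inv_def]
    linarith

theorem exists_one_lt_of_lt_affine (H : IsLeftOrder lt) (hb : lt 1 (b q)) (hq : 1 < q)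
    (hcof : CofinalIn (heightHom q).ker lt) : ∃ x : ℝ, ∀ g, x < affine q g x → lt 1 g := by
  choose c hc using exists_isCut H hb hq hcof
  obtain ⟨x, hx⟩ := exists_eq_affine_sub_of_cocycle hq.ne'
    (fun g h => (hc (g * h)).eq H hq ((hc g).mul H hq (hc h)))
    (by simpa using (hc (b q)).eq H hq (isCut_translation H hb height_b))
  refine ⟨x, fun g hg => (hc g 1 height_one).1 ?_⟩
  rwa [translation_one, hx, sub_pos]

end BS

/-! ### Left-orders induced by the affine action -/

section Induced

variable {G Ω : Type*} [Group G] [LinearOrder Ω] {ρ : G →* (Ω ≃o Ω)} {lt : G → G → Prop}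

theorem IsInducedBy.swap (h : IsInducedBy ρ fun g h => lt h g) : IsInducedBy ρ lt := by
  obtain ⟨x, lt', H, h⟩ := h
  have hinv (g h : G) : (∃ s : stabAt ρ x, g = h * s ∧ lt' 1 s) ↔
      ∃ s : stabAt ρ x, h = g * s ∧ lt' s 1 := by
    constructor
    · rintro ⟨s, rfl, hs⟩
      exact ⟨s⁻¹, by simp, by rwa [H.lt_one_iff, inv_inv]⟩
    · rintro ⟨s, rfl, hs⟩
      exact ⟨s⁻¹, by simp, by rwa [← H.lt_one_iff]⟩
  refine ⟨x, fun s t => lt' t s, H.swap, h.symm.imp (fun h g k => ?_) fun h g k => ?_⟩ <;>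
    exact (h k g).trans (or_congr_right (hinv g k))

theorem IsLeftOrder.isInducedBy (H : IsLeftOrder lt) {x : Ω} (hx : ∀ g, x < ρ g x → lt 1 g) :
    IsInducedBy ρ lt := by
  have lt_of_apply_lt (g h : G) (hgh : ρ g x < ρ h x) : lt g h := by
    rw [H.lt_iff_one_lt]
    refine hx _ ((ρ g).lt_iff_lt.mp ?_)
    rwa [← RelIso.mul_apply, ← map_mul, mul_inv_cancel_left]
  refine ⟨x, fun s t => lt s t, H.restrict _, Or.inl fun g h => ⟨fun hgh => ?_, ?_⟩⟩
  · rcases lt_trichotomy (ρ g x) (ρ h x) with hlt | heq | hgt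
    · exact Or.inl hlt
    · have hstab : ρ (g⁻¹ * h) x = x := by
        rw [map_mul, RelIso.mul_apply, ← heq, ← RelIso.mul_apply, ← map_mul, inv_mul_cancel,
          map_one, RelIso.one_apply]
      exact Or.inr ⟨⟨g⁻¹ * h, hstab⟩, by simp, (H.lt_iff_one_lt g h).mp hgh⟩
    · exact absurd hgh (H.asymm (lt_of_apply_lt h g hgt))
  · rintro (hlt | ⟨s, rfl, hs⟩)
    · exact lt_of_apply_lt g h hlt
    · exact (H.lt_mul_iff g s).mpr hs

end Induced

namespace BS

variable {q : ℤ} [NeZero q] {lt : BS q → BS q → Prop}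

theorem dominatedBy_or_isInducedBy_of_one_lt_b (hq : 2 ≤ |q|) (H : IsLeftOrder lt)
    (hb : lt 1 (b q)) :
    DominatedBy lt (heightHom q) ∨ ∃ h : 0 < q, IsInducedBy (bsAffine q h) lt := by
  refine (H.dominatedBy_or_cofinalIn_ker _ (mem_ker_heightHom.mpr height_b) hb).imp_right
    fun hcof => ?_
  have hpos := pos_of_cofinalIn H hb hcof
  rw [abs_of_pos hpos] at hq
  obtain ⟨x, hx⟩ := exists_one_lt_of_lt_affine H hb (by omega) hcof
  exact ⟨hpos, H.isInducedBy fun g hg => hx g (by rwa [← bsAffine_apply hpos])⟩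

theorem dominatedBy_or_isInducedBy (hq : 2 ≤ |q|) (H : IsLeftOrder lt) :
    DominatedBy lt (heightHom q) ∨ ∃ h : 0 < q, IsInducedBy (bsAffine q h) lt := by
  rcases H.eq_or_lt_or_gt 1 (b q) with hb | hb | hb
  · simpa using congrArg translation hb
  · exact dominatedBy_or_isInducedBy_of_one_lt_b hq H hb
  · rcases dominatedBy_or_isInducedBy_of_one_lt_b hq H.swap hb with ⟨ε, hε⟩ | ⟨hpos, hind⟩
    · refine Or.inl ⟨-ε, fun g hg => ?_⟩
      have hinv : lt g⁻¹ 1 := hε g⁻¹ (by simpa using hg)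
      rwa [H.lt_one_iff, inv_inv] at hinv
    · exact Or.inr ⟨hpos, hind.swap⟩

theorem isInducedBy_of_isRegularLeftOrder {X : Type*} [Finite X] {π : FreeMonoid X →* BS q}
    (hq : 2 ≤ |q|) (H : IsRegularLeftOrder π lt) :
    ∃ h : 0 < q, IsInducedBy (bsAffine q h) lt :=
  (dominatedBy_or_isInducedBy hq H.1).resolve_left
    (not_dominatedBy_heightHom_of_isRegularLeftOrder hq H)

end BS

/-! ### One-counter languages -/

namespace PDA

variable {X A S Γ : Type*}

theorem Run.trans {M : PDA X S Γ} {c c' c'' : S × List Γ} {v w : List X} (h : M.Run c v c')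
    (h' : M.Run c' w c'') : M.Run c (v ++ w) c'' := by
  induction h with
  | nil => exact h'
  | cons hs _ ih =>
    rw [List.append_assoc]
    exact .cons hs (ih h')

theorem Step.run {M : PDA X S Γ} {c c' : S × List Γ} {o : Option X} (h : M.Step c o c') :
    M.Run c o.toList c' := by
  simpa using Run.cons h (.nil c')

/-- `M.Reads σ c g c'`: reading some word with value `g` under `σ` leads from the configuration `c`
to `c'`. -/
def Reads {G : Type*} [Monoid G] (M : PDA X S Γ) (σ : FreeMonoid X →* G) (c : S × List Γ) (g : G)
    (c' : S × List Γ) : Prop :=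
  ∃ w, M.Run c w c' ∧ σ (FreeMonoid.ofList w) = g

section Reads

variable {G : Type*} [Monoid G] {M : PDA X S Γ} {σ : FreeMonoid X →* G} {c c' c'' : S × List Γ}
  {g h : G}

theorem Reads.refl : M.Reads σ c 1 c := ⟨[], .nil c, map_one σ⟩

theorem Reads.mul (hg : M.Reads σ c g c') (hh : M.Reads σ c' h c'') : M.Reads σ c (g * h) c'' := by
  obtain ⟨v, hv, rfl⟩ := hg
  obtain ⟨w, hw, rfl⟩ := hh
  exact ⟨v ++ w, hv.trans hw, by rw [FreeMonoid.ofList_append, map_mul]⟩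

theorem Reads.pow (hg : M.Reads σ c g c) (n : ℕ) : M.Reads σ c (g ^ n) c := by
  induction n with
  | zero => simpa using Reads.refl
  | succ n ih =>
    rw [pow_succ]
    exact ih.mul hg

theorem Step.reads {x : X} (h : M.Step c (some x) c') : M.Reads σ c (σ (.of x)) c' :=
  ⟨[x], h.run, rfl⟩

theorem Step.reads_one (h : M.Step c none c') : M.Reads σ c 1 c' := ⟨[], h.run, map_one σ⟩

theorem Reads.induction {P : S × List Γ → G → Prop} (hP : P c g)
    (step : ∀ {c o c' g}, P c g → M.Step c o c' → P c' (g * o.elim 1 (σ ∘ .of)))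
    (hh : M.Reads σ c h c') : P c' (g * h) := by
  obtain ⟨w, hrun, rfl⟩ := hh
  induction hrun generalizing g with
  | nil => simpa using hP
  | @cons c d _ o w hstep _ ih =>
    have hval : σ (FreeMonoid.ofList (o.toList ++ w)) =
        o.elim 1 (σ ∘ .of) * σ (FreeMonoid.ofList w) := by
      cases o
      · exact (one_mul _).symm
      · exact map_mul σ _ _
    rw [hval, ← mul_assoc]
    exact ih (step hP hstep)

theorem image_accepts :
    {g | ∃ w ∈ M.accepts, σ (FreeMonoid.ofList w) = g} =
      {g | ∃ c, M.Reads σ (M.start, M.stack₀) g c ∧ c.1 ∈ M.accept} := by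
  ext g
  exact ⟨fun ⟨w, ⟨c, hrun, hacc⟩, hw⟩ => ⟨c, ⟨w, hrun, hw⟩, hacc⟩,
    fun ⟨c, ⟨w, hrun, hw⟩, hacc⟩ => ⟨w, ⟨c, hrun, hacc⟩, hw⟩⟩

end Reads

theorem dropLast_append_getLast?_toList (u : List Γ) : u.dropLast ++ u.getLast?.toList = u := by
  induction u using List.reverseRecOn <;> simp

theorem step_of_keep_mem {M : PDA X S Γ} {s s' : S} {o : Option X} {u : List Γ}
    (h : (s', u.getLast?.toList) ∈ M.δ s o u.getLast?) : M.Step (s, u) o (s', u) :=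
  ⟨_, h, (dropLast_append_getLast?_toList u).symm⟩

/-- The positions in the words `f x`, together with a position in the empty word; they are the
second components of the states of `PDA.substitute`. -/
abbrev Position (f : A → List X) : Type _ := Σ o : Option A, Fin ((o.elim [] f).length + 1)

/-- The part of the word that follows a given position. -/
def Position.rest {f : A → List X} (p : Position f) : List X := (p.1.elim [] f).drop p.2

@[simp] theorem Position.rest_zero {f : A → List X} (o : Option A) :
    Position.rest (f := f) ⟨o, 0⟩ = o.elim [] f := rfl

theorem Position.exists_rest_eq_of_cons {f : A → List X} {p : Position f} {x : X} {w : List X}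
    (h : p.rest = x :: w) : ∃ p' : Position f, p'.rest = w := by
  obtain ⟨o, i, hi⟩ := p
  have hlt : i < (o.elim [] f).length := by
    by_contra! hle
    simp [rest, List.drop_eq_nil_of_le hle] at h
  refine ⟨⟨o, i + 1, Nat.succ_lt_succ hlt⟩, ?_⟩
  rw [rest, List.drop_eq_getElem_cons hlt] at h
  exact (List.cons.inj h).2

/-- The automaton that reads the word `f x` wherever `M` reads the letter `x`. A move of `M` becomes
a spontaneous move, after which the word still has to be read. -/
def substitute [Finite A] (M : PDA A S Γ) (f : A → List X) : PDA X (S × Position f) Γ where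
  δ c o t := match o with
    | some x => {d | ∃ p, c.2.rest = x :: p.rest ∧ d = ((c.1, p), t.toList)}
    | none => {d | c.2.rest = [] ∧ ∃ o, (d.1.1, d.2) ∈ M.δ c.1 o t ∧ d.1.2 = ⟨o, 0⟩}
  finite_δ c o t := by
    cases o with
    | some x =>
      refine (Set.finite_range fun p => ((c.1, p), t.toList)).subset ?_
      rintro _ ⟨p, -, rfl⟩
      exact ⟨p, rfl⟩
    | none =>
      refine (Set.finite_iUnion fun o =>
        (M.finite_δ c.1 o t).image fun d => ((d.1, (⟨o, 0⟩ : Position f)), d.2)).subset ?_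
      rintro ⟨⟨s, _⟩, u⟩ ⟨-, o, hu, rfl⟩
      exact Set.mem_iUnion.mpr ⟨o, _, hu, rfl⟩
  start := (M.start, ⟨none, 0⟩)
  stack₀ := M.stack₀
  accept := {c | c.1 ∈ M.accept ∧ c.2.rest = []}

section substitute

variable [Finite A] {M : PDA A S Γ} {f : A → List X}

theorem Run.of_substitute {c c' : (S × Position f) × List Γ} {w : List X}
    (h : (M.substitute f).Run c w c') (hc' : c'.1.2.rest = []) :
    ∃ v : List A, w = c.1.2.rest ++ v.flatMap f ∧ M.Run (c.1.1, c.2) v (c'.1.1, c'.2) := by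
  induction h with
  | nil c => exact ⟨[], by simp [hc'], .nil _⟩
  | @cons c d _ o w hstep _ ih =>
    obtain ⟨v, rfl, hv⟩ := ih hc'
    obtain ⟨⟨s, p⟩, u⟩ := c
    obtain ⟨⟨s', p'⟩, u'⟩ := d
    obtain ⟨t, ht, rfl : u' = _⟩ := hstep
    cases o with
    | some x =>
      obtain ⟨_, hp, ⟨⟩⟩ := ht
      refine ⟨v, by simp [show p.rest = _ from hp], ?_⟩
      rwa [dropLast_append_getLast?_toList] at hv
    | none =>
      obtain ⟨hp, o, ho, rfl : p' = _⟩ := ht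
      refine ⟨o.toList ++ v, ?_, .cons ⟨t, ho, rfl⟩ hv⟩
      cases o <;> simp [show p.rest = _ from hp]

theorem exists_run_rest (s : S) (u : List Γ) (p : Position f) : ∃ p' : Position f, p'.rest = [] ∧
    (M.substitute f).Run ((s, p), u) p.rest ((s, p'), u) := by
  obtain ⟨w, hw⟩ : ∃ w, p.rest = w := ⟨_, rfl⟩
  rw [hw]
  induction w generalizing p with
  | nil => exact ⟨p, hw, .nil _⟩
  | cons x w ih =>
    obtain ⟨p', rfl⟩ := Position.exists_rest_eq_of_cons hw
    obtain ⟨p'', hp'', hrun⟩ := ih p' rfl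
    exact ⟨p'', hp'', .cons (o := some x) (step_of_keep_mem ⟨p', hw, rfl⟩) hrun⟩

theorem Run.substitute {c c' : S × List Γ} {v : List A} (h : M.Run c v c') {p : Position f}
    (hp : p.rest = []) : ∃ p' : Position f, p'.rest = [] ∧
      (M.substitute f).Run ((c.1, p), c.2) (v.flatMap f) ((c'.1, p'), c'.2) := by
  induction h generalizing p with
  | nil c => exact ⟨p, hp, .nil _⟩
  | @cons c d _ o v hstep _ ih =>
    obtain ⟨u, hu, hd⟩ := hstep
    have hmove : (M.substitute f).Step ((c.1, p), c.2) none ((d.1, ⟨o, 0⟩), d.2) :=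
      ⟨u, ⟨hp, o, hu, rfl⟩, hd⟩
    obtain ⟨p₁, hp₁, hread⟩ := exists_run_rest (M := M) d.1 d.2 (⟨o, 0⟩ : Position f)
    obtain ⟨p₂, hp₂, hrest⟩ := ih hp₁
    refine ⟨p₂, hp₂, ?_⟩
    have hword : (o.toList ++ v).flatMap f = o.elim [] f ++ v.flatMap f := by cases o <;> simp
    rw [hword]
    exact hmove.run.trans (hread.trans hrest)

theorem accepts_substitute :
    (M.substitute f).accepts = {w | ∃ v ∈ M.accepts, v.flatMap f = w} := by
  ext w
  constructor
  · rintro ⟨c, hrun, hacc, hrest⟩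
    obtain ⟨v, hv, hvrun⟩ := hrun.of_substitute hrest
    exact ⟨v, ⟨_, hvrun, hacc⟩, hv.symm⟩
  · rintro ⟨v, ⟨c, hrun, hacc⟩, rfl⟩
    obtain ⟨p, hp, hprun⟩ := hrun.substitute (f := f) (p := ⟨none, 0⟩) rfl
    exact ⟨_, hprun, hacc, hp⟩

end substitute

/-- A deterministic finite automaton, as a pushdown automaton that never writes on its stack. -/
def ofDFA (M : DFA X S) : PDA X S Unit where
  δ s o _ := o.elim ∅ fun x => {(M.step s x, [])}
  finite_δ s o _ := by cases o <;> simp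
  start := M.start
  stack₀ := []
  accept := M.accept

theorem Run.eq_evalFrom {M : DFA X S} {c c' : S × List Unit} {w : List X}
    (h : (ofDFA M).Run c w c') : c'.1 = M.evalFrom c.1 w := by
  induction h with
  | nil => rfl
  | @cons c d _ o w hstep _ ih =>
    obtain ⟨u, hu, -⟩ := hstep
    cases o with
    | none => exact hu.elim
    | some x =>
      rw [ih]
      exact congrArg (M.evalFrom · w) (congrArg Prod.fst hu)

theorem run_ofDFA (M : DFA X S) (w : List X) (s : S) :
    (ofDFA M).Run (s, []) w (M.evalFrom s w, []) := by
  induction w generalizing s with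
  | nil => exact .nil _
  | cons x w ih => exact .cons (o := some x) (c' := (M.step s x, [])) ⟨[], rfl, rfl⟩ (ih _)

theorem accepts_ofDFA (M : DFA X S) : (ofDFA M).accepts = M.accepts := by
  ext w
  constructor
  · rintro ⟨c, hrun, hacc⟩
    rw [hrun.eq_evalFrom] at hacc
    exact hacc
  · exact fun hw => ⟨_, run_ofDFA M w M.start, hw⟩

end PDA

theorem IsOneCounter.image_flatMap {A : Type} {X : Type*} [Finite A] {L : Language A}
    (hL : IsOneCounter L) (f : A → List X) :
    IsOneCounter ({w | ∃ v ∈ L, v.flatMap f = w} : Language X) := by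
  obtain ⟨S, Γ, _, M, hΓ, rfl⟩ := hL
  exact ⟨S × PDA.Position f, Γ, inferInstance, M.substitute f, hΓ, PDA.accepts_substitute⟩

theorem IsRepresentedBy.of_surjective {A : Type} {X G : Type*} [Finite A] [Group G]
    {σ : FreeMonoid A →* G} {π : FreeMonoid X →* G} {P : Set G}
    (h : IsRepresentedBy IsOneCounter σ P) (hπ : Function.Surjective π) :
    IsRepresentedBy IsOneCounter π P := by
  obtain ⟨L, hL, rfl⟩ := h
  choose f hf using fun x : A => hπ (σ (FreeMonoid.of x))
  have map_flatMap (v : List A) :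
      π (FreeMonoid.ofList (v.flatMap fun x => (f x).toList)) = σ (FreeMonoid.ofList v) := by
    induction v with
    | nil => exact (map_one π).trans (map_one σ).symm
    | cons x v ih =>
      rw [List.flatMap_cons, FreeMonoid.ofList_append, map_mul, ih, FreeMonoid.ofList_toList, hf,
        FreeMonoid.ofList_cons, map_mul]
  refine ⟨_, hL.image_flatMap fun x => (f x).toList, ?_⟩
  ext g
  constructor
  · rintro ⟨_, ⟨v, hv, rfl⟩, rfl⟩
    exact ⟨v, hv, (map_flatMap v).symm⟩
  · rintro ⟨v, hv, rfl⟩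
    exact ⟨_, ⟨v, hv, rfl⟩, map_flatMap v⟩

theorem isOneCounter_of_isRegular {X : Type*} {L : Language X} (hL : L.IsRegular) :
    IsOneCounter L := by
  obtain ⟨σ, _, M, rfl⟩ := hL
  exact ⟨σ, Unit, inferInstance, PDA.ofDFA M, Nat.card_unique, PDA.accepts_ofDFA M⟩

theorem IsRegularLeftOrder.isOneCounterLeftOrder {X G : Type*} [Group G] {π : FreeMonoid X →* G}
    {lt : G → G → Prop} (H : IsRegularLeftOrder π lt) : IsOneCounterLeftOrder π lt := by
  obtain ⟨hlt, L, hL, hP⟩ := H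
  exact ⟨hlt, L, isOneCounter_of_isRegular hL, hP⟩

/-! ### A one-counter left-order on `BS(1, q)` for `q ≠ 0` -/

namespace BS

/-- The input letters of `heightPDA`. -/
inductive Letter
  | down
  | up
  | b
  | bInv
  | a

/-- The states of `heightPDA`. -/
inductive Phase
  | descend
  | ascend
  | bottom
  | positive

instance : Finite Letter :=
  Set.finite_univ_iff.mp <| (Set.toFinite {.down, .up, .b, .bInv, .a}).subset fun x _ => by
    cases x <;> simp

instance : Finite Phase :=
  Set.finite_univ_iff.mp <| (Set.toFinite {.descend, .ascend, .bottom, .positive}).subset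
    fun s _ => by cases s <;> simp

/-- The moves of `heightPDA`: the stack counts the letters `down` that are not yet matched by a
letter `up`, and `bottom` is reached when the stack has become empty again. -/
inductive HeightMove : Phase → Option Letter → Option Unit → Phase × List Unit → Prop
  | push (t) : HeightMove .descend (some .down) t (.descend, t.toList ++ [()])
  | turn (t) : HeightMove .descend (some .b) t (.ascend, t.toList)
  | ascend_b (t) : HeightMove .ascend (some .b) t (.ascend, t.toList)
  | pop : HeightMove .ascend (some .up) (some ()) (.ascend, [])
  | land : HeightMove .ascend none none (.bottom, [])
  | leave (t) : HeightMove .bottom (some .a) t (.positive, t.toList)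
  | positive_a (t) : HeightMove .positive (some .a) t (.positive, t.toList)
  | positive_b (t) : HeightMove .positive (some .b) t (.positive, t.toList)
  | positive_bInv (t) : HeightMove .positive (some .bInv) t (.positive, t.toList)

/-- An automaton for the positive cone `heightCone`. In the state `bottom` the word read so far is
`downⁿ bᵐ⁰ up bᵐ¹ up ⋯`, with `n` letters `up` and at least one letter `b`. -/
def heightPDA : PDA Letter Phase Unit where
  δ s o t := {d | HeightMove s o t d}
  finite_δ s o t :=
    (Set.finite_univ.prod (Set.toFinite {[], t.toList, t.toList ++ [()]})).subset <| by
      rintro _ (_ | _ | _ | _ | _ | _ | _ | _ | _) <;> simp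
  start := .descend
  stack₀ := []
  accept := {.bottom, .positive}

/-- The element of `BS(1, q)` that a letter stands for. The exponents of `a` in `down` and `up` are
even so that, also for negative `q`, the powers of `b` read before the state `bottom` is reached
contribute positively to the translation part. -/
def Letter.toBS (q : ℤ) : Letter → BS q
  | .down => (BS.a q ^ 2)⁻¹
  | .up => BS.a q ^ 2
  | .b => BS.b q
  | .bInv => (BS.b q)⁻¹
  | .a => BS.a q

/-- The homomorphism `Letter* → BS(1, q)` determined by `Letter.toBS`. -/
def Letter.eval (q : ℤ) : FreeMonoid Letter →* BS q := FreeMonoid.lift (toBS q)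

@[simp] theorem Letter.eval_of (q : ℤ) (x : Letter) : eval q (.of x) = x.toBS q :=
  FreeMonoid.lift_eval_of _ x

/-- The invariant satisfied by the element `g` that has been read when `heightPDA` is in the
configuration `c`. -/
def HeightInvariant {q : ℤ} [NeZero q] (c : Phase × List Unit) (g : BS q) : Prop :=
  match c.1 with
  | .descend => height g = -2 * c.2.length ∧ translation g = 0
  | .ascend => height g = -2 * c.2.length ∧ 0 < translation g
  | .bottom => height g = 0 ∧ 0 < translation g
  | .positive => 0 < height g

variable {q : ℤ} [NeZero q]

theorem zpow_two_mul_pos (k : ℤ) : 0 < (q : ℝ) ^ (2 * k) :=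
  (even_two_mul k).zpow_pos cast_ne_zero

theorem HeightInvariant.mul_b {u u' : List Unit} {g : BS q}
    (hg : height g = -2 * u.length ∧ 0 ≤ translation g) (hu : u' = u) :
    HeightInvariant (.ascend, u') (g * b q) := by
  subst hu
  refine ⟨by simp [hg.1], ?_⟩
  have hpos : 0 < (q : ℝ) ^ height g := by
    rw [hg.1, neg_mul, ← mul_neg]
    exact zpow_two_mul_pos _
  rw [translation_mul, translation_b, mul_one]
  exact add_pos_of_nonneg_of_pos hg.2 hpos

theorem HeightInvariant.step {c d : Phase × List Unit} {o : Option Letter} {g : BS q}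
    (hg : HeightInvariant c g) (h : heightPDA.Step c o d) :
    HeightInvariant d (g * o.elim 1 (Letter.eval q ∘ .of)) := by
  obtain ⟨s, u⟩ := c
  obtain ⟨s', u'⟩ := d
  obtain ⟨v, hv, hu'⟩ := h
  have keep : u.dropLast ++ u.getLast?.toList = u := PDA.dropLast_append_getLast?_toList u
  replace hv : HeightMove s o u.getLast? (s', v) := hv
  replace hu' : u' = u.dropLast ++ v := hu'
  generalize ht : u.getLast? = t at hv keep
  cases hv with
  | push t =>
    obtain ⟨hh, htr⟩ : height g = -2 * u.length ∧ translation g = 0 := hg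
    rw [← List.append_assoc, keep] at hu'
    refine ⟨?_, by simp [Letter.toBS, translation_mul, translation_inv, htr]⟩
    simp [Letter.toBS, hu', hh, mul_add]
  | turn t => exact .mul_b ⟨hg.1, hg.2.ge⟩ (hu'.trans keep)
  | ascend_b t => exact .mul_b ⟨hg.1, hg.2.le⟩ (hu'.trans keep)
  | pop =>
    obtain ⟨hh, htr⟩ : height g = -2 * u.length ∧ 0 < translation g := hg
    have hlen : u.length = u'.length + 1 := by
      rw [← keep, hu', List.append_nil, Option.toList_some, List.length_append,
        List.length_singleton]
    refine ⟨?_, by simpa [Letter.toBS, translation_mul] using htr⟩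
    simp [Letter.toBS, hh, hlen, mul_add]
  | land =>
    obtain ⟨hh, htr⟩ : height g = -2 * u.length ∧ 0 < translation g := hg
    rw [List.getLast?_eq_none_iff.mp ht] at hh
    exact ⟨by simpa using hh, by simpa using htr⟩
  | leave t =>
    obtain ⟨hh, -⟩ : height g = 0 ∧ 0 < translation g := hg
    simp [HeightInvariant, Letter.toBS, hh]
  | positive_a t =>
    replace hg : 0 < height g := hg
    simpa [HeightInvariant, Letter.toBS] using hg.trans (lt_add_one _)
  | positive_b t => simpa [HeightInvariant, Letter.toBS] using hg
  | positive_bInv t => simpa [HeightInvariant, Letter.toBS] using hg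

section Reads

omit [NeZero q]

theorem reads_of_keep {s s' : Phase} {x : Letter} (h : ∀ t, HeightMove s (some x) t (s', t.toList))
    (u : List Unit) : heightPDA.Reads (Letter.eval q) (s, u) (x.toBS q) (s', u) := by
  rw [← Letter.eval_of]
  exact (PDA.step_of_keep_mem (M := heightPDA) (h _)).reads

theorem reads_descend (n : ℕ) : heightPDA.Reads (Letter.eval q) (.descend, [])
    (a q ^ (2 * n))⁻¹ (.descend, List.replicate n ()) := by
  induction n with
  | zero => simpa using PDA.Reads.refl
  | succ n ih =>
    have hpush : heightPDA.Step (.descend, List.replicate n ()) (some .down)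
        (.descend, List.replicate (n + 1) ()) :=
      ⟨_, .push _, by
        rw [← List.append_assoc, PDA.dropLast_append_getLast?_toList, List.replicate_succ']⟩
    have hval : (a q ^ (2 * (n + 1)))⁻¹ = (a q ^ (2 * n))⁻¹ * Letter.eval q (.of .down) := by
      rw [Letter.eval_of, Letter.toBS, ← mul_inv_rev, ← pow_add, mul_add_one, add_comm]
    rw [hval]
    exact ih.mul hpush.reads

theorem reads_ascend (n : ℕ) : heightPDA.Reads (Letter.eval q) (.ascend, List.replicate n ())
    (a q ^ (2 * n)) (.ascend, []) := by
  induction n with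
  | zero => simpa using PDA.Reads.refl
  | succ n ih =>
    have hpop : heightPDA.Step (.ascend, List.replicate (n + 1) ()) (some .up)
        (.ascend, List.replicate n ()) :=
      ⟨[], by simpa [heightPDA, List.getLast?_replicate] using HeightMove.pop, by simp⟩
    have hval : a q ^ (2 * (n + 1)) = Letter.eval q (.of .up) * a q ^ (2 * n) := by
      rw [Letter.eval_of, Letter.toBS, ← pow_add, mul_add_one, add_comm]
    rw [hval]
    exact hpop.reads.mul ih

theorem reads_bottom (n m : ℕ) : heightPDA.Reads (Letter.eval q) (.descend, [])
    ((a q ^ (2 * n))⁻¹ * b q ^ (m + 1) * a q ^ (2 * n)) (.bottom, []) := by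
  have hland : heightPDA.Step (.ascend, []) none (.bottom, []) := ⟨[], .land, rfl⟩
  have hb : heightPDA.Reads (Letter.eval q) (.descend, List.replicate n ()) (b q * b q ^ m)
      (.ascend, List.replicate n ()) :=
    (reads_of_keep .turn _).mul ((reads_of_keep .ascend_b _).pow m)
  rw [← pow_succ'] at hb
  rw [← mul_one (_ * _ * _)]
  exact (((reads_descend n).mul hb).mul (reads_ascend n)).mul hland.reads_one

theorem reads_positive (k : ℕ) (j : ℤ) : heightPDA.Reads (Letter.eval q) (.bottom, [])
    (a q ^ (k + 1) * b q ^ j) (.positive, []) := by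
  rw [pow_succ']
  refine ((reads_of_keep .leave []).mul ((reads_of_keep .positive_a []).pow k)).mul ?_
  obtain ⟨j, rfl | rfl⟩ := j.eq_nat_or_neg
  · simpa [Letter.toBS] using (reads_of_keep (q := q) .positive_b []).pow j
  · simpa [Letter.toBS] using (reads_of_keep (q := q) .positive_bInv []).pow j

end Reads

theorem exists_eq_of_height_eq_zero {g : BS q} (hh : height g = 0) (ht : 0 < translation g) :
    ∃ n m : ℕ, g = (a q ^ (2 * n))⁻¹ * b q ^ (m + 1) * a q ^ (2 * n) := by
  obtain ⟨N, hN⟩ := exists_translation_mem_lattice g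
  obtain ⟨m, hm⟩ := lattice_mono (show N ≤ (2 * N.toNat : ℕ) by omega) hN
  replace hm : translation g = (q : ℝ) ^ (-((2 * N.toNat : ℕ) : ℤ)) * m := by
    simpa [mul_comm] using hm.symm
  have hmpos : 0 < m := by
    have hq : 0 < (q : ℝ) ^ (-((2 * N.toNat : ℕ) : ℤ)) := by
      push_cast
      rw [← mul_neg]
      exact zpow_two_mul_pos _
    rwa [hm, mul_pos_iff_of_pos_left hq, Int.cast_pos] at ht
  obtain ⟨j, rfl⟩ : ∃ j : ℕ, m = (j + 1 : ℕ) := ⟨(m - 1).toNat, by omega⟩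
  refine ⟨N.toNat, j, ext_height_translation (by simp [hh]) ?_⟩
  rw [hm, ← translation_normal_form, zpow_natCast, zpow_natCast]

theorem exists_int_mul_lt {c : ℝ} (hc : c ≠ 0) (x : ℝ) : ∃ j : ℤ, c * j < x := by
  rcases lt_or_gt_of_ne hc with hc | hc
  · obtain ⟨j, hj⟩ := exists_int_gt (x / c)
    exact ⟨j, by rwa [div_lt_iff_of_neg' hc] at hj⟩
  · obtain ⟨j, hj⟩ := exists_int_lt (x / c)
    exact ⟨j, by rwa [lt_div_iff₀' hc] at hj⟩

theorem reads_of_mem_heightCone {g : BS q} (hg : g ∈ heightCone q) :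
    ∃ s ∈ heightPDA.accept, heightPDA.Reads (Letter.eval q) (.descend, []) g (s, []) := by
  have reads_of_height_eq_zero {g : BS q} (hh : height g = 0) (ht : 0 < translation g) :
      heightPDA.Reads (Letter.eval q) (.descend, []) g (.bottom, []) := by
    obtain ⟨n, m, rfl⟩ := exists_eq_of_height_eq_zero hh ht
    exact reads_bottom n m
  rcases hg with hh | ⟨hh, ht⟩
  · refine ⟨.positive, Or.inr rfl, ?_⟩
    obtain ⟨k, hk⟩ : ∃ k : ℕ, height g = k + 1 := ⟨(height g - 1).toNat, by omega⟩
    obtain ⟨j, hj⟩ := exists_int_mul_lt (zpow_ne_zero (height g) (cast_ne_zero (q := q)))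
      (translation g)
    have hbottom := reads_of_height_eq_zero (g := g * (a q ^ (k + 1) * b q ^ j)⁻¹)
      (by simp [hk]) (by
        rw [mul_inv_rev, translation_mul, translation_mul]
        simpa [translation_inv] using hj)
    rw [← inv_mul_cancel_right g (a q ^ (k + 1) * b q ^ j)]
    exact hbottom.mul (reads_positive k j)
  · exact ⟨.bottom, Or.inl rfl, reads_of_height_eq_zero hh ht⟩

theorem image_accepts_heightPDA :
    {g | ∃ w ∈ heightPDA.accepts, Letter.eval q (FreeMonoid.ofList w) = g} = heightCone q := by
  rw [PDA.image_accepts]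
  ext g
  constructor
  · rintro ⟨c, hreads, hacc⟩
    have hstart : HeightInvariant (q := q) (.descend, []) 1 := by simp [HeightInvariant]
    have hg : HeightInvariant c (1 * g) := PDA.Reads.induction hstart HeightInvariant.step hreads
    obtain ⟨s, u⟩ := c
    rw [one_mul] at hg
    rcases hacc with rfl | rfl
    · exact Or.inr hg
    · exact Or.inl hg
  · intro hg
    obtain ⟨s, hs, hreads⟩ := reads_of_mem_heightCone hg
    exact ⟨_, hreads, hs⟩

theorem isOneCounterLeftOrder_heightCone {X : Type*} {π : FreeMonoid X →* BS q}
    (hπ : Function.Surjective π) :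
    IsOneCounterLeftOrder π fun g h => g⁻¹ * h ∈ heightCone q := by
  refine ⟨(isPositiveCone_heightCone q).isLeftOrder, ?_⟩
  rw [posCone_inv_mul_mem]
  exact IsRepresentedBy.of_surjective ⟨heightPDA.accepts,
    ⟨Phase, Unit, inferInstance, heightPDA, Nat.card_unique, rfl⟩, image_accepts_heightPDA⟩ hπ

end BS

theorem mainTheorem2 (q : ℤ) {X : Type*} [Finite X] (π : FreeMonoid X →* BS q)
    (hπ : Function.Surjective π) :
    (∃ lt : BS q → BS q → Prop, IsOneCounterLeftOrder π lt) ∧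
    ((∃ lt : BS q → BS q → Prop, IsRegularLeftOrder π lt) ↔ -1 ≤ q) ∧
    (∀ hq : 2 ≤ q, ∀ lt : BS q → BS q → Prop, IsRegularLeftOrder π lt →
      IsInducedBy (bsAffine q (by omega)) lt) := by
  refine ⟨?_, ⟨?_, BS.exists_isRegularLeftOrder hπ⟩, ?_⟩
  · by_cases hq : -1 ≤ q
    · obtain ⟨lt, H⟩ := BS.exists_isRegularLeftOrder hπ hq
      exact ⟨lt, H.isOneCounterLeftOrder⟩
    · have : NeZero q := ⟨by omega⟩
      exact ⟨_, BS.isOneCounterLeftOrder_heightCone hπ⟩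
  · rintro ⟨lt, H⟩
    by_contra! hq
    have : NeZero q := ⟨by omega⟩
    obtain ⟨hpos, -⟩ := BS.isInducedBy_of_isRegularLeftOrder (le_abs.mpr (Or.inr (by omega))) H
    omega
  · intro hq lt H
    have : NeZero q := ⟨by omega⟩
    obtain ⟨_, hind⟩ := BS.isInducedBy_of_isRegularLeftOrder (le_abs.mpr (Or.inl hq)) H
    exact hind
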